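/- Let $F$ be a totally real number field with ring of integers $\mathcal O_F$, and fix a real embedding $\iota\colon F\hookrightarrow\mathbb R$ (through which $F$ is regarded as a subfield of $\mathbb R$). Identify $F\otimes\mathbb R=\mathbb R^{\mathrm{Hom}(F,\mathbb R)}$, and let $F\otimes\mathbb R_+$ be its totally positive part (all coordinates positive). Let $\mathfrak f$ be a nonzero integral ideal of $F$ and $\mathfrak p$ a nonzero prime ideal with $\mathfrak p\nmid\mathfrak f$; let $F_{\mathfrak p}$ be the completion of $F$ at $\mathfrak p$ and $\mathcal O_{F_{\mathfrak p}}$ its ring of integers. Put $F_{\mathfrak f}^\times:=\{z\in F^\times \mid z\equiv 1 \bmod^* \mathfrak f\}$, i.e. the set of nonzero $z=a/b$ with $a,b\in\mathcal O_F$, $b\ne0$ prime to $\mathfrak f$ and $a\equiv b \bmod \mathfrak f$. For linearly independent $v_1,\dots,v_r\in\mathcal O_F$ ($r\ge 1$), the cone with basis $\bm v=(v_1,\dots,v_r)$ is $C(\bm v):=\{\sum_i t_iv_i\in F\otimes\mathbb R \mid t_i>0\}$. A Shintani set is a subset $D\subset F\otimes\mathbb R_+$ that is a finite disjoint union of cones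 whose bases consist of totally positive elements of $\mathcal O_F$. A nonzero prime ideal $\eta$ of $F$ is good for a cone $C(v_1,\dots,v_r)$ if $v_i\in\mathcal O_F-\eta$ for all $i$ and $N\eta$ is a rational prime; it is good for a Shintani set $D$ if $D$ is a finite disjoint union of cones for which $\eta$ is good. For a set $R$ of totally positive elements of $F$, let $\zeta_N(s,R)$ and $\zeta(s,R)$ be the meromorphic continuations to $\mathbb C$, when they exist, of $\sum_{z\in R}(Nz)^{-s}$ and $\sum_{z\in R}\iota(z)^{-s}$, respectively, both series being taken for $\Re(s)$ sufficiently large. Let $\eta$ be a nonzero prime ideal of $F$ with $(N\eta,\mathfrak f\mathfrak p)=1$, let $\mathfrak b$ be a nonzero fractional ideal of $F$ relatively prime to $\mathfrak f\mathfrak pN\eta$, let $D$ be a Shintani set, and let $\mathcal U\subset\mathcal O_{F_{\mathfrak p}}$ be an open compact subset. Put $$\nu(\mathfrak b,D,\mathcal U):=\zeta_N(0,F_{\mathfrak f}^\times\cap\mathfrak b^{-1}\cap D\cap\mathcal U),\qquad \nu_\eta(\mathfrak b,D,\mathcal U):=\nu(\mathfrak b,D,\mathcal U)-N\eta\,\nu(\mathfrak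 b\eta^{-1},D,\mathcal U).$$ Assume that $\eta$ is good for $D$. Then the zeta functions $\zeta_N(s,R)$ and $\zeta(s,R)$ exist and are analytic at $s=0$ for $R=F_{\mathfrak f}^\times\cap\mathfrak b^{-1}\cap D\cap\mathcal U$ and for $R=F_{\mathfrak f}^\times\cap\mathfrak b^{-1}\eta\cap D\cap\mathcal U$, and $$\nu_\eta(\mathfrak b,D,\mathcal U)=\zeta(0,F_{\mathfrak f}^\times\cap\mathfrak b^{-1}\cap D\cap\mathcal U)-N\eta\,\zeta(0,F_{\mathfrak f}^\times\cap\mathfrak b^{-1}\eta\cap D\cap\mathcal U).$$ -/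

import Mathlib

open scoped nonZeroDivisors NumberField

noncomputable section

namespace ShintaniZeta

open IsDedekindDomain

variable {F : Type*} [Field F] [NumberField F]

/-! ### Cones and Shintani sets -/

/-- The image of `z : F` under `F ⊗ ℝ = ℝ^n`, the coordinates being indexed by the real
embeddings of `F` (used for totally real `F`). -/
def embed (z : F) : (F →+* ℝ) → ℝ := fun τ => τ z

/-- The open cone `C(v) = {∑ tᵢ vᵢ | tᵢ > 0}` in `F ⊗ ℝ`. -/
def cone {r : ℕ} (v : Fin r → 𝓞 F) : Set ((F →+* ℝ) → ℝ) :=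
  {y | ∃ t : Fin r → ℝ, (∀ i, 0 < t i) ∧ y = ∑ i, t i • embed (v i : F)}

/-- `D` is the disjoint union of the finitely many cones `C(v j)`, each `v j` being a nonempty
linearly independent family of integers of `F`. -/
def IsConeDecomposition (D : Set ((F →+* ℝ) → ℝ)) {k : ℕ} (r : Fin k → ℕ)
    (v : ∀ j, Fin (r j) → 𝓞 F) : Prop :=
  (∀ j, 0 < r j) ∧
  (∀ j, LinearIndependent ℚ (fun i => (v j i : F))) ∧
  Pairwise (fun j j' => Disjoint (cone (v j)) (cone (v j'))) ∧
  D = ⋃ j, cone (v j)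

/-- A Shintani set: a finite disjoint union of cones with totally positive integral bases. -/
def IsShintaniSet (D : Set ((F →+* ℝ) → ℝ)) : Prop :=
  ∃ (k : ℕ) (r : Fin k → ℕ) (v : ∀ j, Fin (r j) → 𝓞 F),
    IsConeDecomposition D r v ∧ ∀ j i (τ : F →+* ℝ), 0 < τ (v j i : F)

/-- `η` is good for the cone with basis `v`: no `vᵢ` lies in `η`, and `Nη` is a rational prime. -/
def IsGoodForCone (η : HeightOneSpectrum (𝓞 F)) {r : ℕ} (v : Fin r → 𝓞 F) : Prop :=
  (∀ i, v i ∉ η.asIdeal) ∧ (Ideal.absNorm η.asIdeal).Prime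

/-- `η` is good for `D`: `D` is a finite disjoint union of cones for which `η` is good. -/
def IsGoodFor (η : HeightOneSpectrum (𝓞 F)) (D : Set ((F →+* ℝ) → ℝ)) : Prop :=
  ∃ (k : ℕ) (r : Fin k → ℕ) (v : ∀ j, Fin (r j) → 𝓞 F),
    IsConeDecomposition D r v ∧ ∀ j, IsGoodForCone η (v j)

/-! ### The index sets -/

/-- `F_𝔣^× = {z ∈ F^× | z ≡ 1 mod^* 𝔣}`: the nonzero quotients `a / b` of integers with `b` prime
to `𝔣` and `a ≡ b mod 𝔣`. -/
def rayUnits (𝔣 : Ideal (𝓞 F)) : Set F :=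
  {z | z ≠ 0 ∧ ∃ a b : 𝓞 F, b ≠ 0 ∧ IsCoprime (Ideal.span {b}) 𝔣 ∧ a - b ∈ 𝔣 ∧
    z = (a : F) / (b : F)}

/-- `F_𝔣^× ∩ I ∩ D ∩ 𝓤`, for a fractional ideal `I`, `D ⊆ F ⊗ ℝ` and `𝓤 ⊆ F_𝔭`. -/
def indexSet (𝔣 : Ideal (𝓞 F)) (𝔭 : HeightOneSpectrum (𝓞 F))
    (I : FractionalIdeal (𝓞 F)⁰ F) (D : Set ((F →+* ℝ) → ℝ)) (𝓤 : Set (𝔭.adicCompletion F)) :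
    Set F :=
  {z | z ∈ rayUnits 𝔣 ∧ z ∈ I ∧ embed z ∈ D ∧ algebraMap F (𝔭.adicCompletion F) z ∈ 𝓤}

/-! ### Zeta functions of subsets of `F` and their values at `s = 0` -/

/-- `Z` is a meromorphic continuation to `ℂ`, analytic at `s = 0`, of the Dirichlet series
`∑_{z ∈ R} g(z)^{-s}`, which converges absolutely on some right half-plane. -/
def IsContinuation {X : Type*} (R : Set X) (g : X → ℝ) (Z : ℂ → ℂ) : Prop :=
  (∃ σ : ℝ, ∀ s : ℂ, σ < s.re → HasSum (fun z : R => ((g z : ℝ) : ℂ) ^ (-s)) (Z s)) ∧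
  MeromorphicOn Z Set.univ ∧ AnalyticAt ℂ Z 0

/-- The Dirichlet series `∑_{z ∈ R} g(z)^{-s}` has a meromorphic continuation analytic at `0`. -/
def HasContinuation {X : Type*} (R : Set X) (g : X → ℝ) : Prop := ∃ Z, IsContinuation R g Z

/-- The value at `s = 0` does not depend on the continuation. -/
theorem IsContinuation.value_unique {X : Type*} {R : Set X} {g : X → ℝ}
    {Z W : ℂ → ℂ} (hZ : IsContinuation R g Z) (hW : IsContinuation R g W) : Z 0 = W 0 := by
  obtain ⟨⟨σ, hσ⟩, hZm, hZa⟩ := hZ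
  obtain ⟨⟨ρ, hρ⟩, hWm, hWa⟩ := hW
  have hm : MeromorphicOn (Z - W) Set.univ := hZm.sub hWm
  have h1 : meromorphicOrderAt (Z - W) ((max σ ρ + 1 : ℝ) : ℂ) = ⊤ := by
    rw [meromorphicOrderAt_eq_top_iff]
    apply Filter.Eventually.filter_mono nhdsWithin_le_nhds
    have ho : IsOpen {s : ℂ | max σ ρ < s.re} := isOpen_lt continuous_const Complex.continuous_re
    filter_upwards [ho.mem_nhds (show max σ ρ < (((max σ ρ + 1 : ℝ) : ℂ)).re by simp)] with s hs
    have hs' : max σ ρ < s.re := hs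
    have := (hσ s ((le_max_left _ _).trans_lt hs')).unique (hρ s ((le_max_right _ _).trans_lt hs'))
    simp [this]
  have h0 : meromorphicOrderAt (Z - W) 0 = ⊤ := by
    by_contra h
    exact hm.meromorphicOrderAt_ne_top_of_isPreconnected (x := 0)
      isPreconnected_univ (Set.mem_univ _) (Set.mem_univ _) h h1
  have ha : AnalyticAt ℂ (Z - W) 0 := hZa.sub hWa
  rw [meromorphicOrderAt_eq_top_iff] at h0
  have h2 := ha.frequently_zero_iff_eventually_zero.mp h0.frequently
  exact sub_eq_zero.mp h2.self_of_nhds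

open Classical in
/-- The value at `s = 0` of the continuation of `∑_{z ∈ R} g(z)^{-s}` (`0` if there is none). -/
def valueAtZero {X : Type*} (R : Set X) (g : X → ℝ) : ℂ :=
  if h : HasContinuation R g then h.choose 0 else 0

/-- The norm `F → ℝ`, used for the zeta functions `ζ_N(s, R) = ∑_{z ∈ R} Nz^{-s}`. -/
def normReal (z : F) : ℝ := ((Algebra.norm ℚ z : ℚ) : ℝ)

/-- `ζ_N(0, R)`. -/
def zetaNormAtZero (R : Set F) : ℂ := valueAtZero R normReal

/-- `ζ_ι(0, R)`, where `ζ_ι(s, R) = ∑_{z ∈ R} ι(z)^{-s}`. -/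
def zetaAtZero (ι : F →+* ℝ) (R : Set F) : ℂ := valueAtZero R ι

/-! ### Dasgupta's measure -/

/-- `ν(𝔟, D, 𝓤) = ζ_N(0, F_𝔣^× ∩ 𝔟⁻¹ ∩ D ∩ 𝓤)`. -/
def nu (𝔣 : Ideal (𝓞 F)) (𝔭 : HeightOneSpectrum (𝓞 F)) (𝔟 : FractionalIdeal (𝓞 F)⁰ F)
    (D : Set ((F →+* ℝ) → ℝ)) (𝓤 : Set (𝔭.adicCompletion F)) : ℂ :=
  zetaNormAtZero (indexSet 𝔣 𝔭 𝔟⁻¹ D 𝓤)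

/-- `ν_η(𝔟, D, 𝓤) = ν(𝔟, D, 𝓤) - Nη ν(𝔟η⁻¹, D, 𝓤)`. -/
def nuEta (𝔣 : Ideal (𝓞 F)) (𝔭 η : HeightOneSpectrum (𝓞 F)) (𝔟 : FractionalIdeal (𝓞 F)⁰ F)
    (D : Set ((F →+* ℝ) → ℝ)) (𝓤 : Set (𝔭.adicCompletion F)) : ℂ :=
  nu 𝔣 𝔭 𝔟 D 𝓤 -
    (Ideal.absNorm η.asIdeal : ℂ) *
      nu 𝔣 𝔭 (𝔟 * (η.asIdeal : FractionalIdeal (𝓞 F)⁰ F)⁻¹) D 𝓤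

end ShintaniZeta

end

/-! For a finite family T of real embeddings and a set S of points of D, consider the series of ∏_{t
∈ T} t(z)^{-s} over z ∈ S. All real embeddings together give ζ_N, and ι alone gives the other zeta
function. Cutting each cone into translates of a half-open box makes a periodic S a finite union of
orbits x + ∑ nᵢ M vᵢ, so everything reduces to sums over n ∈ ℕ^r.

The semigroup algebra of translations acts on functions. An element of the k-th power of the
augmentation ideal lowers the order of growth of ∏ u_τ^{-s} by k (`decays_of_mem_pow`), so it moves
the domain of convergence to the left. For k ≥ 1 it also kills the constant 1, which is the product
at s = 0. Splitting n by parity expresses such a sum by 2^{r-k-ms} times itself, m = |T|, and a sum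
with an operator in the next power (`latticeSum_halving`). Iterating gives the continuation. At s =
0 only the denominator for k = r vanishes; its zero is simple and is cancelled by the zero of the
last sum.

For a sum twisted by ξ^n with all ξᵢ ≠ 1, the operator ∏ (1 - ξᵢ[vᵢ]) undoes the summation and is
invertible modulo every power of the augmentation ideal. The twisted sum is therefore regular at 0
with value ∏ (1 - ξᵢ)⁻¹, whatever T is (`exists_continuation_twisted`).

Finally, orthogonality of the characters ψ of 𝓞/η, a group of prime order q = Nη, writes the
q-smoothed zeta function as minus the sum of its twists by the nontrivial ψ. Since vᵢ ∉ η and the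
period M can be chosen prime to q, all twists are different from 1. Hence the smoothed value at 0
does not depend on T (`exists_smoothed_value`), and the two choices of T are compared. -/

open scoped nonZeroDivisors NumberField

noncomputable section

namespace ShintaniZeta

open scoped NNReal

/-! ### Translation operators -/

section Translation

variable {T : Type*}

/-- The inclusion of vectors with nonnegative coordinates into all real vectors. -/
def realVec (h : T → ℝ≥0) : T → ℝ := fun τ => h τ

@[simp] lemma realVec_apply (h : T → ℝ≥0) (τ : T) : realVec h τ = h τ := rfl

@[simp] lemma realVec_zero : realVec (0 : T → ℝ≥0) = 0 := rfl

@[simp] lemma realVec_add (h k : T → ℝ≥0) : realVec (h + k) = realVec h + realVec k := rfl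

lemma realVec_nsmul (n : ℕ) (h : T → ℝ≥0) : realVec (n • h) = n • realVec h := by
  ext τ; simp

/-- The algebra of finite combinations of translations by nonnegative vectors. -/
abbrev TransAlg (T : Type*) := AddMonoidAlgebra ℂ (T → ℝ≥0)

/-- The translation by `h`, as an element of the algebra. -/
def trans (h : T → ℝ≥0) : TransAlg T := AddMonoidAlgebra.single h 1

lemma trans_add (h k : T → ℝ≥0) : trans (h + k) = trans h * trans k := by
  simp [trans, AddMonoidAlgebra.single_mul_single]

lemma transAlg_induction {motive : TransAlg T → Prop} (c : TransAlg T)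
    (h1 : ∀ h, motive (trans h)) (h2 : ∀ x y, motive x → motive y → motive (x + y))
    (h3 : ∀ (a : ℂ) x, motive x → motive (a • x)) : motive c :=
  AddMonoidAlgebra.induction_on c (fun m => h1 m) h2 h3

/-- The action of the translation algebra on functions. -/
def act : TransAlg T →ₐ[ℂ] Module.End ℂ ((T → ℝ) → ℂ) :=
  AddMonoidAlgebra.lift ℂ _ _
    { toFun := fun h =>
        { toFun := fun f u => f (u + realVec h.toAdd)
          map_add' := fun _ _ => rfl
          map_smul' := fun _ _ => rfl }
      map_one' := by ext f u; simp
      map_mul' := fun h k => by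
        ext f u
        simp only [toAdd_mul, realVec_add, LinearMap.coe_mk, AddHom.coe_mk, Module.End.mul_apply]
        congr 1
        abel }

lemma act_trans (h : T → ℝ≥0) (f : (T → ℝ) → ℂ) (u : T → ℝ) :
    act (trans h) f u = f (u + realVec h) := by
  simp [act, trans, AddMonoidAlgebra.lift_single]

lemma act_mul (c d : TransAlg T) (f : (T → ℝ) → ℂ) : act (c * d) f = act c (act d f) := by
  rw [map_mul]; rfl

lemma act_add (c d : TransAlg T) (f : (T → ℝ) → ℂ) (u : T → ℝ) :
    act (c + d) f u = act c f u + act d f u := by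
  rw [map_add]; rfl

lemma act_sub (c d : TransAlg T) (f : (T → ℝ) → ℂ) (u : T → ℝ) :
    act (c - d) f u = act c f u - act d f u := by
  rw [map_sub]; rfl

lemma act_smul (a : ℂ) (c : TransAlg T) (f : (T → ℝ) → ℂ) (u : T → ℝ) :
    act (a • c) f u = a * act c f u := by
  rw [map_smul]; rfl

lemma act_sum {κ : Type*} (s : Finset κ) (c : κ → TransAlg T) (f : (T → ℝ) → ℂ) (u : T → ℝ) :
    act (∑ i ∈ s, c i) f u = ∑ i ∈ s, act (c i) f u := by
  rw [map_sum, LinearMap.sum_apply, Finset.sum_apply]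

/-- The augmentation ideal, spanned by the differences `[h] - 1`. -/
def augIdeal (T : Type*) : Ideal (TransAlg T) := Ideal.span (Set.range fun h => trans h - 1)

lemma trans_sub_one_mem (h : T → ℝ≥0) : trans h - 1 ∈ augIdeal T :=
  Ideal.subset_span ⟨h, rfl⟩

lemma trans_sub_trans_mem (h k : T → ℝ≥0) : trans h - trans k ∈ augIdeal T := by
  have := (augIdeal T).sub_mem (trans_sub_one_mem h) (trans_sub_one_mem k)
  simpa using this

/-- The endomorphism `[h] ↦ [h / 2]`. -/
def halve : TransAlg T →ₐ[ℂ] TransAlg T :=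
  AddMonoidAlgebra.mapDomainAlgHom ℂ ℂ (DistribSMul.toAddMonoidHom (T → ℝ≥0) (2⁻¹ : ℝ≥0))

lemma halve_trans (h : T → ℝ≥0) : halve (trans h) = trans ((2⁻¹ : ℝ≥0) • h) := by
  simp [halve, trans]

lemma half_smul_add_self (h : T → ℝ≥0) : (2⁻¹ : ℝ≥0) • h + (2⁻¹ : ℝ≥0) • h = h := by
  ext τ
  simp only [Pi.add_apply, Pi.smul_apply, smul_eq_mul, NNReal.coe_add, NNReal.coe_mul,
    NNReal.coe_inv, NNReal.coe_ofNat]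
  ring

/-- Halving preserves the augmentation, since it sends translations to translations. -/
lemma halve_sub_self_mem (c : TransAlg T) : halve c - c ∈ augIdeal T := by
  induction c using transAlg_induction with
  | h1 h => rw [halve_trans]; exact trans_sub_trans_mem _ _
  | h2 x y hx hy =>
    have := (augIdeal T).add_mem hx hy
    rw [map_add]
    convert this using 1
    ring
  | h3 a x hx =>
    have := Submodule.smul_of_tower_mem (augIdeal T) a hx
    rw [map_smul, ← smul_sub]
    exact this

/-- Modulo the square of the ideal, [h] - 1 is additive in h, so halving h halves its class.
Explicitly, with w = [h/2], (w - 1) - (w² - 1)/2 = -(w - 1)²/2. -/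
lemma halve_sub_half_mem {d : TransAlg T} (hd : d ∈ augIdeal T) :
    halve d - (2⁻¹ : ℂ) • d ∈ augIdeal T ^ 2 := by
  unfold augIdeal at hd
  induction hd using Submodule.span_induction with
  | mem x hx =>
    obtain ⟨h, rfl⟩ := hx
    have h1 : trans h = trans ((2⁻¹ : ℝ≥0) • h) * trans ((2⁻¹ : ℝ≥0) • h) := by
      rw [← trans_add, half_smul_add_self]
    have h2 : halve (trans h - 1) - (2⁻¹ : ℂ) • (trans h - 1) =
        (-2⁻¹ : ℂ) • (trans ((2⁻¹ : ℝ≥0) • h) - 1) ^ 2 := by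
      rw [map_sub, map_one, halve_trans, h1]
      set w := trans ((2⁻¹ : ℝ≥0) • h)
      simp only [Algebra.smul_def, map_neg]
      have : (algebraMap ℂ (TransAlg T)) 2⁻¹ * 2 = 1 := by
        rw [← map_ofNat (algebraMap ℂ (TransAlg T)) 2, ← map_mul, inv_mul_cancel₀ two_ne_zero,
          map_one]
      linear_combination (1 - w) * this
    simp only [h2]
    exact Submodule.smul_of_tower_mem _ _ (Ideal.pow_mem_pow (trans_sub_one_mem _) 2)
  | zero => simp
  | add x y _ _ hx hy =>
    have := Ideal.add_mem _ hx hy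
    rw [map_add, smul_add]
    convert this using 1
    ring
  | smul a x hx' hx =>
    have e : halve (a • x) - (2⁻¹ : ℂ) • a • x =
        (halve a - a) * halve x + a * (halve x - (2⁻¹ : ℂ) • x) := by
      simp only [smul_eq_mul, map_mul, Algebra.smul_def]
      ring
    rw [e]
    refine Ideal.add_mem _ ?_ (Ideal.mul_mem_left _ _ hx)
    rw [pow_two]
    refine Ideal.mul_mem_mul (halve_sub_self_mem a) ?_
    have := Ideal.add_mem _ (halve_sub_self_mem x) hx'
    simpa using this

/-- Halving acts as 2⁻¹ on the first graded piece of the augmentation filtration, hence by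
multiplicativity as 2^{-k} on the k-th. This factor produces the denominators of the continuation.
-/
lemma halve_sub_mem_pow (k : ℕ) {c : TransAlg T} (hc : c ∈ augIdeal T ^ k) :
    halve c - ((2 : ℂ) ^ k)⁻¹ • c ∈ augIdeal T ^ (k + 1) := by
  induction k generalizing c with
  | zero => simpa using halve_sub_self_mem c
  | succ k ih =>
    rw [pow_succ] at hc
    induction hc using Submodule.mul_induction_on' with
    | mem_mul_mem a ha b hb =>
      have e : halve (a * b) - ((2 : ℂ) ^ (k + 1))⁻¹ • (a * b) =
          (halve a - ((2 : ℂ) ^ k)⁻¹ • a) * halve b +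
            (((2 : ℂ) ^ k)⁻¹ • a) * (halve b - (2⁻¹ : ℂ) • b) := by
        simp only [map_mul, Algebra.smul_def, pow_succ, mul_inv]
        ring
      rw [e]
      refine Ideal.add_mem _ ?_ ?_
      · rw [pow_succ _ (k + 1)]
        refine Ideal.mul_mem_mul (ih ha) ?_
        have := Ideal.add_mem _ (halve_sub_self_mem b) hb
        simpa using this
      · rw [add_assoc k 1 1, pow_add _ k]
        exact Ideal.mul_mem_mul (Submodule.smul_of_tower_mem _ _ ha) (halve_sub_half_mem hb)
    | add x _ y _ hx hy =>
      have := Ideal.add_mem _ hx hy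
      rw [map_add, smul_add]
      convert this using 1
      ring

/-- The constant 1 is the product of powers at s = 0, so this controls all values there. -/
lemma act_one_eq_zero {c : TransAlg T} (hc : c ∈ augIdeal T) :
    act c (fun _ => (1 : ℂ)) = 0 := by
  unfold augIdeal at hc
  induction hc using Submodule.span_induction with
  | mem x hx =>
    obtain ⟨h, rfl⟩ := hx
    ext u
    simp [act_trans]
  | zero => simp
  | add x y _ _ hx hy => rw [map_add, LinearMap.add_apply, hx, hy, add_zero]
  | smul a x _ hx => rw [smul_eq_mul, act_mul, hx, map_zero]

end Translation

/-! ### Decay of iterated differences of products of powers -/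

section Decay

variable {T : Type*}

lemma sector_add {κ R H : ℝ} (hκ : 1 ≤ κ) (hR : 1 ≤ R) (hH : 0 ≤ H) {u h : T → ℝ}
    (hu : ∀ τ, κ⁻¹ * R ≤ u τ ∧ u τ ≤ κ * R) (hh : ∀ τ, 0 ≤ h τ ∧ h τ ≤ H) (τ : T) :
    (κ + H)⁻¹ * R ≤ (u + h) τ ∧ (u + h) τ ≤ (κ + H) * R := by
  have h1 : (κ + H)⁻¹ ≤ κ⁻¹ := inv_anti₀ (by linarith) (by linarith)
  have h2 := hu τ
  have h3 := hh τ
  rw [Pi.add_apply]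
  constructor
  · nlinarith
  · nlinarith

variable [Fintype T]

/-- The function `u ↦ ∏ u_τ ^ (-w_τ)`. -/
def powFun (w : T → ℂ) (u : T → ℝ) : ℂ := ∏ τ, (u τ : ℂ) ^ (-w τ)

lemma norm_powFun (w : T → ℂ) {u : T → ℝ} (hu : ∀ τ, 0 < u τ) :
    ‖powFun w u‖ = ∏ τ, u τ ^ (-(w τ).re) := by
  rw [powFun, norm_prod]
  refine Finset.prod_congr rfl fun τ _ => ?_
  rw [Complex.norm_cpow_eq_rpow_re_of_pos (hu τ), Complex.neg_re]

/-- The exponents vary separately so that the family is closed under differentiation: each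
derivative raises one exponent by 1. -/
lemma hasDerivAt_powFun [DecidableEq T] (w : T → ℂ) (u h : T → ℝ) (t : ℝ)
    (hu : ∀ τ, 0 < (u + t • h) τ) :
    HasDerivAt (fun t : ℝ => powFun w (u + t • h))
      (∑ τ, -(w τ * h τ) * powFun (w + Pi.single τ 1) (u + t • h)) t := by
  have h1 : ∀ τ ∈ (Finset.univ : Finset T), HasDerivAt
      (fun t : ℝ => (((u + t • h) τ : ℝ) : ℂ) ^ (-w τ))
      (-w τ * (((u + t • h) τ : ℝ) : ℂ) ^ (-w τ - 1) * h τ) t := by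
    intro τ _
    have h2 : HasDerivAt (fun z : ℂ => (u τ : ℂ) + z * h τ) (h τ) (t : ℂ) := by
      simpa using ((hasDerivAt_id (t : ℂ)).mul_const (h τ : ℂ)).const_add (u τ : ℂ)
    have h3 : (u τ : ℂ) + (t : ℂ) * h τ ∈ Complex.slitPlane := by
      have := Complex.ofReal_mem_slitPlane.2 (hu τ)
      simpa using this
    have h4 := (h2.cpow_const (c := -w τ) h3).comp_ofReal
    simpa using h4
  have h5 := HasDerivAt.fun_finsetProd h1
  refine h5.congr_deriv (Finset.sum_congr rfl fun τ _ => ?_)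
  rw [powFun, ← Finset.prod_erase_mul _ _ (Finset.mem_univ τ)]
  have h6 : ∏ σ ∈ Finset.univ.erase τ,
      (((u + t • h) σ : ℝ) : ℂ) ^ (-(w + Pi.single τ (1 : ℂ) : T → ℂ) σ) =
      ∏ σ ∈ Finset.univ.erase τ, (((u + t • h) σ : ℝ) : ℂ) ^ (-w σ) := by
    refine Finset.prod_congr rfl fun σ hσ => ?_
    rw [Pi.add_apply w, Pi.single_eq_of_ne (Finset.ne_of_mem_erase hσ), add_zero]
  rw [h6, Pi.add_apply w, Pi.single_eq_same, neg_add, smul_eq_mul, ← sub_eq_add_neg]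
  ring

lemma hasDerivAt_act_powFun [DecidableEq T] (c : TransAlg T) (w : T → ℂ) (u h : T → ℝ) (t : ℝ)
    (hu : ∀ τ, 0 < (u + t • h) τ) :
    HasDerivAt (fun t : ℝ => act c (powFun w) (u + t • h))
      (∑ τ, -(w τ * h τ) * act c (powFun (w + Pi.single τ 1)) (u + t • h)) t := by
  induction c using transAlg_induction with
  | h1 k =>
    simp only [act_trans]
    have h1 : ∀ t : ℝ, u + t • h + realVec k = (u + realVec k) + t • h := fun t => by abel
    simp only [h1]
    refine hasDerivAt_powFun w _ h t fun τ => ?_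
    rw [← h1]
    exact add_pos_of_pos_of_nonneg (hu τ) (k τ).2
  | h2 x y hx hy =>
    simp only [act_add, mul_add, Finset.sum_add_distrib]
    exact hx.add hy
  | h3 a x hx =>
    simp only [act_smul]
    refine (hx.const_mul a).congr_deriv ?_
    rw [Finset.mul_sum]
    exact Finset.sum_congr rfl fun τ _ => by ring

/-- `c` maps products of powers of total degree `-∑ w_τ` to functions of order
`-∑ Re w_τ - k`, locally uniformly in `w` and along sectors. -/
def Decays (k : ℕ) (c : TransAlg T) : Prop :=
  ∀ κ B : ℝ, 1 ≤ κ → 0 ≤ B → ∃ C : ℝ, 0 ≤ C ∧ ∀ w : T → ℂ, (∀ τ, ‖w τ‖ ≤ B) → ∀ R : ℝ, 1 ≤ R →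
    ∀ u : T → ℝ, (∀ τ, κ⁻¹ * R ≤ u τ ∧ u τ ≤ κ * R) →
      ‖act c (powFun w) u‖ ≤ C * R ^ (-(∑ τ, (w τ).re) - k)

lemma Decays.add {k : ℕ} {c d : TransAlg T} (hc : Decays k c) (hd : Decays k d) :
    Decays k (c + d) := by
  intro κ B hκ hB
  obtain ⟨C, hC, h1⟩ := hc κ B hκ hB
  obtain ⟨C', hC', h2⟩ := hd κ B hκ hB
  refine ⟨C + C', by positivity, fun w hw R hR u hu => ?_⟩
  rw [act_add, add_mul]
  exact (norm_add_le _ _).trans (add_le_add (h1 w hw R hR u hu) (h2 w hw R hR u hu))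

lemma Decays.smul {k : ℕ} {c : TransAlg T} (a : ℂ) (hc : Decays k c) : Decays k (a • c) := by
  intro κ B hκ hB
  obtain ⟨C, hC, h1⟩ := hc κ B hκ hB
  refine ⟨‖a‖ * C, by positivity, fun w hw R hR u hu => ?_⟩
  rw [act_smul, norm_mul, mul_assoc]
  exact mul_le_mul_of_nonneg_left (h1 w hw R hR u hu) (norm_nonneg a)

/-- A translation moves u into a slightly larger sector, where each coordinate is comparable to R.
The sign of the exponent decides which side of the sector is used; either costs at most (κ + H)^B
per coordinate. -/
lemma decays_zero (c : TransAlg T) : Decays 0 c := by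
  induction c using transAlg_induction with
  | h2 x y hx hy => exact hx.add hy
  | h3 a x hx => exact hx.smul a
  | h1 h =>
    intro κ B hκ hB
    set H : ℝ := ∑ τ, (h τ : ℝ) with hH
    have hH0 : 0 ≤ H := Finset.sum_nonneg fun τ _ => (h τ).2
    have hκ' : 1 ≤ κ + H := by linarith
    refine ⟨∏ _τ : T, (κ + H) ^ B, by positivity, fun w hw R hR u hu => ?_⟩
    have hs := sector_add hκ hR hH0 hu (h := realVec h) fun τ =>
      ⟨(h τ).2, Finset.single_le_sum (f := fun τ => (h τ : ℝ)) (fun τ _ => (h τ).2)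
        (Finset.mem_univ τ)⟩
    have hR0 : 0 < R := by linarith
    have hpos : ∀ τ, 0 < (u + realVec h) τ := fun τ =>
      lt_of_lt_of_le (by positivity) (hs τ).1
    rw [act_trans, norm_powFun w hpos, Nat.cast_zero, sub_zero, ← Finset.sum_neg_distrib,
      Real.rpow_sum_of_pos hR0, ← Finset.prod_mul_distrib]
    refine Finset.prod_le_prod (fun τ _ => (Real.rpow_nonneg (hpos τ).le _)) fun τ _ => ?_
    obtain ⟨a, ha⟩ : ∃ a, a = -(w τ).re := ⟨_, rfl⟩
    rw [← ha]
    have haB : |a| ≤ B := by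
      rw [ha, abs_neg]; exact (Complex.abs_re_le_norm _).trans (hw τ)
    rcases le_total 0 a with h0 | h0
    · calc (u + realVec h) τ ^ a ≤ ((κ + H) * R) ^ a :=
            Real.rpow_le_rpow (hpos τ).le (hs τ).2 h0
        _ = (κ + H) ^ a * R ^ a := Real.mul_rpow (by linarith) hR0.le
        _ ≤ _ := by
          gcongr
          · exact (le_abs_self a).trans haB
    · calc (u + realVec h) τ ^ a ≤ ((κ + H)⁻¹ * R) ^ a :=
            Real.rpow_le_rpow_of_nonpos (by positivity) (hs τ).1 h0
        _ = (κ + H) ^ (-a) * R ^ a := by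
          rw [Real.mul_rpow (by positivity) hR0.le, Real.inv_rpow (by linarith),
            Real.rpow_neg (by linarith)]
        _ ≤ _ := by
          gcongr
          · exact (neg_le_abs a).trans haB

/-- Mean value inequality on the segment from u to u + h: the difference is bounded by derivatives,
in which one exponent is larger by 1. This gains a factor R⁻¹ and explains the bound B + 1 and the
sector κ + H below. -/
lemma Decays.mul_trans_sub_one {k : ℕ} {c : TransAlg T} (hc : Decays k c) (h : T → ℝ≥0) :
    Decays (k + 1) (c * (trans h - 1)) := by
  classical
  intro κ B hκ hB
  set H : ℝ := ∑ τ, (h τ : ℝ) with hH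
  have hH0 : 0 ≤ H := Finset.sum_nonneg fun τ _ => (h τ).2
  obtain ⟨C, hC, h1⟩ := hc (κ + H) (B + 1) (by linarith) (by linarith)
  refine ⟨∑ τ, B * h τ * C, by positivity, fun w hw R hR u hu => ?_⟩
  have hR0 : 0 < R := by linarith
  have e : act (c * (trans h - 1)) (powFun w) u =
      act c (powFun w) (u + (1 : ℝ) • realVec h) - act c (powFun w) (u + (0 : ℝ) • realVec h) := by
    rw [mul_comm, act_mul, act_sub, act_trans, map_one, one_smul, zero_smul, add_zero]
    rfl
  have hs : ∀ t ∈ Set.Icc (0 : ℝ) 1, ∀ τ, (κ + H)⁻¹ * R ≤ (u + t • realVec h) τ ∧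
      (u + t • realVec h) τ ≤ (κ + H) * R := by
    intro t ht
    refine sector_add hκ hR hH0 hu fun τ => ⟨mul_nonneg ht.1 (h τ).2, ?_⟩
    have h2 : (h τ : ℝ) ≤ H := Finset.single_le_sum (f := fun τ => (h τ : ℝ))
      (fun τ _ => (h τ).2) (Finset.mem_univ τ)
    have h3 : (0 : ℝ) ≤ h τ := (h τ).2
    have h4 := mul_le_of_le_one_left h3 ht.2
    simpa using h4.trans h2
  rw [e]
  refine norm_image_sub_le_of_norm_deriv_le_segment_01'
    (f := fun t : ℝ => act c (powFun w) (u + t • realVec h)) (fun t ht =>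
    (hasDerivAt_act_powFun c w u (realVec h) t fun τ =>
      lt_of_lt_of_le (by positivity) (hs t ht τ).1).hasDerivWithinAt) fun t ht => ?_
  have ht' : t ∈ Set.Icc (0 : ℝ) 1 := ⟨ht.1, ht.2.le⟩
  refine (norm_sum_le _ _).trans ?_
  rw [Finset.sum_mul]
  refine Finset.sum_le_sum fun τ _ => ?_
  have h5 := h1 (w + Pi.single τ 1) (fun σ => by
    rw [Pi.add_apply]
    refine (norm_add_le _ _).trans (add_le_add (hw σ) ?_)
    rcases eq_or_ne σ τ with rfl | hne
    · simp
    · simp [Pi.single_eq_of_ne hne]) R hR _ (hs t ht')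
  have h6 : ∑ σ, ((w + Pi.single τ (1 : ℂ) : T → ℂ) σ).re = ∑ σ, (w σ).re + 1 := by
    simp only [Pi.add_apply, Complex.add_re, Finset.sum_add_distrib, add_right_inj]
    rw [Finset.sum_eq_single τ]
    · simp
    · intro σ _ hne; simp [Pi.single_eq_of_ne hne]
    · simp
  have h7 : -(∑ σ, (w σ).re + 1) - (k : ℝ) = -(∑ σ, (w σ).re) - ((k + 1 : ℕ) : ℝ) := by
    push_cast; ring
  rw [h6, h7] at h5
  rw [norm_mul, norm_neg, norm_mul, mul_assoc _ C]
  have h8 : ‖((realVec h τ : ℝ) : ℂ)‖ = h τ := by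
    rw [Complex.norm_real, realVec_apply, Real.norm_of_nonneg (h τ).coe_nonneg]
  rw [h8]
  gcongr
  exact hw τ

/-- Elements of the `k`-th power of the augmentation ideal lower the order by `k`. -/
lemma decays_of_mem_pow (k : ℕ) {c : TransAlg T} (hc : c ∈ augIdeal T ^ k) : Decays k c := by
  induction k generalizing c with
  | zero => exact decays_zero c
  | succ k ih =>
    rw [pow_succ] at hc
    induction hc using Submodule.mul_induction_on' with
    | add x _ y _ hx hy => exact hx.add hy
    | mem_mul_mem a ha b hb =>
      unfold augIdeal at hb
      induction hb using Submodule.span_induction generalizing a with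
      | mem x hx =>
        obtain ⟨h, rfl⟩ := hx
        exact (ih ha).mul_trans_sub_one h
      | zero =>
        rw [mul_zero, ← zero_smul ℂ (a * (trans 0 - 1))]
        exact ((ih ha).mul_trans_sub_one 0).smul 0
      | add x y _ _ hx hy =>
        rw [mul_add]
        exact (hx a ha).add (hy a ha)
      | smul d x _ hx =>
        rw [smul_eq_mul, ← mul_assoc]
        exact hx _ (Ideal.mul_mem_right _ _ ha)

end Decay

/-! ### Convergence of the lattice sums -/

lemma exists_bound_of_pos {J : Type*} [Fintype J] (a : J → ℝ) (ha : ∀ j, 0 < a j) :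
    ∃ κ : ℝ, 1 ≤ κ ∧ ∀ j, κ⁻¹ ≤ a j ∧ a j ≤ κ := by
  have h0 : ∀ j ∈ (Finset.univ : Finset J), 0 ≤ a j + (a j)⁻¹ := fun j _ => by
    have := ha j; positivity
  refine ⟨1 + ∑ j, (a j + (a j)⁻¹), by linarith [Finset.sum_nonneg h0], fun j => ?_⟩
  have h1 := Finset.single_le_sum h0 (Finset.mem_univ j)
  have h2 := ha j
  have h3 : 0 < (a j)⁻¹ := inv_pos.2 h2
  constructor
  · rw [inv_le_comm₀ (by linarith) h2]
    linarith
  · linarith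

lemma summable_prod_inv_sq (r : ℕ) :
    Summable fun n : Fin r → ℕ => ∏ i, ((1 + n i : ℝ) ^ 2)⁻¹ := by
  induction r with
  | zero => exact Summable.of_finite
  | succ r ih =>
    have h1 : Summable fun n : ℕ => ((1 + n : ℝ) ^ 2)⁻¹ := by
      have := (summable_nat_add_iff 1).2 (Real.summable_nat_pow_inv.2 (le_refl 2))
      refine this.congr fun n => ?_
      push_cast
      rw [add_comm]
    have h2 := h1.mul_of_nonneg ih (fun n => by positivity) (fun n => by positivity)
    rw [← (Fin.consEquiv fun _ : Fin (r + 1) => ℕ).summable_iff]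
    refine h2.congr fun n => ?_
    simp [Fin.prod_univ_succ, Fin.consEquiv, mul_comm]

section Series

variable {T : Type*} {r : ℕ}

/-- The vector `∑ nᵢ vᵢ`. -/
def comb (v : Fin r → T → ℝ≥0) (n : Fin r → ℕ) : T → ℝ≥0 := ∑ i, n i • v i

/-- Since x and all vᵢ have positive coordinates, the whole orbit stays in one sector, with R = 1 +
∑ nᵢ. -/
lemma comb_sector (x : T → ℝ≥0) (v : Fin r → T → ℝ≥0) {κ : ℝ}
    (hx : ∀ τ, κ⁻¹ ≤ x τ ∧ x τ ≤ κ) (hv : ∀ i τ, κ⁻¹ ≤ v i τ ∧ v i τ ≤ κ) (n : Fin r → ℕ) (τ : T) :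
    κ⁻¹ * (1 + ∑ i, (n i : ℝ)) ≤ realVec (x + comb v n) τ ∧
      realVec (x + comb v n) τ ≤ κ * (1 + ∑ i, (n i : ℝ)) := by
  have e : realVec (x + comb v n) τ = x τ + ∑ i, (n i : ℝ) * v i τ := by
    simp [comb, Finset.sum_apply]
  rw [e, mul_add, mul_one, mul_add, mul_one, Finset.mul_sum, Finset.mul_sum]
  constructor
  · refine add_le_add (hx τ).1 (Finset.sum_le_sum fun i _ => ?_)
    rw [mul_comm]
    exact mul_le_mul_of_nonneg_left (hv i τ).1 (by positivity)
  · refine add_le_add (hx τ).2 (Finset.sum_le_sum fun i _ => ?_)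
    rw [mul_comm κ]
    exact mul_le_mul_of_nonneg_left (hv i τ).2 (by positivity)

lemma realVec_comb_pos {x : T → ℝ≥0} (hx : ∀ τ, 0 < x τ) (v : Fin r → T → ℝ≥0) (n : Fin r → ℕ) (τ : T) :
    0 < realVec (x + comb v n) τ := by
  rw [realVec_add]
  exact add_pos_of_pos_of_nonneg (hx τ) (comb v n τ).2

variable [Fintype T] {x : T → ℝ≥0} {v : Fin r → T → ℝ≥0}

/-- The terms are of size R^{-2r} or less, and each of the r factors R⁻² is at most (1 + nᵢ)⁻². The
constant is uniform for bounded s, as holomorphy of the sum requires. -/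
lemma exists_term_bound (hx : ∀ τ, 0 < x τ) (hv : ∀ i τ, 0 < v i τ) {k : ℕ} {c : TransAlg T}
    (hc : c ∈ augIdeal T ^ k) {B : ℝ} (hB : 0 ≤ B) :
    ∃ C : ℝ, ∀ s : ℂ, ‖s‖ ≤ B → 2 * (r : ℝ) ≤ Fintype.card T * s.re + k → ∀ n : Fin r → ℕ,
      ‖act c (powFun fun _ => s) (realVec (x + comb v n))‖ ≤ C * ∏ i, ((1 + n i : ℝ) ^ 2)⁻¹ := by
  obtain ⟨κ, hκ, h1⟩ := exists_bound_of_pos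
    (Sum.elim (fun τ => (x τ : ℝ)) (fun p : Fin r × T => (v p.1 p.2 : ℝ))) (by
      rintro (τ | ⟨i, τ⟩)
      · exact hx τ
      · exact hv i τ)
  obtain ⟨C, hC, h2⟩ := decays_of_mem_pow k hc κ B hκ hB
  refine ⟨C, fun s hs hsk n => ?_⟩
  set R : ℝ := 1 + ∑ i, (n i : ℝ) with hRdef
  have hR : 1 ≤ R := by
    have : (0 : ℝ) ≤ ∑ i, (n i : ℝ) := by positivity
    linarith
  have h3 := h2 (fun _ => s) (fun _ => hs) R hR _
    (comb_sector x v (fun τ => h1 (Sum.inl τ)) (fun i τ => h1 (Sum.inr (i, τ))) n)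
  refine h3.trans (mul_le_mul_of_nonneg_left ?_ hC)
  have h4 : R ^ (-(∑ _τ : T, s.re) - (k : ℝ)) ≤ R ^ (-(2 * (r : ℝ))) := by
    refine Real.rpow_le_rpow_of_exponent_le hR ?_
    rw [Finset.sum_const, Finset.card_univ, nsmul_eq_mul]
    linarith
  refine h4.trans ?_
  have h5 : R ^ (-(2 * (r : ℝ))) = ∏ _i : Fin r, (R ^ 2)⁻¹ := by
    rw [Finset.prod_const, Finset.card_univ, Fintype.card_fin, inv_pow, ← pow_mul,
      Real.rpow_neg (by linarith)]
    congr 1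
    exact_mod_cast Real.rpow_natCast R (2 * r)
  rw [h5]
  refine Finset.prod_le_prod (fun i _ => by positivity) fun i _ => ?_
  have h6 : (n i : ℝ) ≤ ∑ i, (n i : ℝ) :=
    Finset.single_le_sum (f := fun i => (n i : ℝ)) (fun _ _ => by positivity) (Finset.mem_univ i)
  gcongr
  linarith

lemma summable_term (hx : ∀ τ, 0 < x τ) (hv : ∀ i τ, 0 < v i τ) {k : ℕ} {c : TransAlg T}
    (hc : c ∈ augIdeal T ^ k) {s : ℂ} (hs : 2 * (r : ℝ) ≤ Fintype.card T * s.re + k) :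
    Summable fun n : Fin r → ℕ => ‖act c (powFun fun _ => s) (realVec (x + comb v n))‖ := by
  obtain ⟨C, hC⟩ := exists_term_bound hx hv hc (norm_nonneg s)
  exact Summable.of_nonneg_of_le (fun _ => norm_nonneg _) (hC s le_rfl hs)
    ((summable_prod_inv_sq r).mul_left C)

/-- The sum of `b n · (c · ∏ u_τ ^ (-s))(x + ∑ nᵢ vᵢ)`. -/
def latticeSum (b : (Fin r → ℕ) → ℂ) (x : T → ℝ≥0) (v : Fin r → T → ℝ≥0) (c : TransAlg T) (s : ℂ) :
    ℂ :=
  ∑' n, b n * act c (powFun fun _ => s) (realVec (x + comb v n))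

lemma hasSum_latticeSum {b : (Fin r → ℕ) → ℂ} (hb : ∀ n, ‖b n‖ ≤ 1) (hx : ∀ τ, 0 < x τ)
    (hv : ∀ i τ, 0 < v i τ) {k : ℕ} {c : TransAlg T}
    (hc : c ∈ augIdeal T ^ k) {s : ℂ} (hs : 2 * (r : ℝ) ≤ Fintype.card T * s.re + k) :
    HasSum (fun n => b n * act c (powFun fun _ => s) (realVec (x + comb v n)))
      (latticeSum b x v c s) := by
  refine (Summable.of_norm_bounded (summable_term hx hv hc hs) fun n => ?_).hasSum
  rw [norm_mul]
  exact mul_le_of_le_one_left (norm_nonneg _) (hb n)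

lemma differentiable_act_powFun (c : TransAlg T) {u : T → ℝ} (hu : ∀ τ, 0 < u τ) :
    Differentiable ℂ fun s : ℂ => act c (powFun fun _ => s) u := by
  induction c using transAlg_induction with
  | h1 h =>
    simp only [act_trans, powFun]
    refine Differentiable.fun_finsetProd fun τ _ => ?_
    refine Differentiable.const_cpow (by fun_prop) (Or.inl ?_)
    have : 0 < (u + realVec h) τ := add_pos_of_pos_of_nonneg (hu τ) (h τ).2
    exact_mod_cast this.ne'
  | h2 x y hx hy => simp only [act_add]; exact hx.add hy
  | h3 a x hx => simp only [act_smul]; exact hx.const_mul a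

/-- The lattice sum is holomorphic where the exponents ensure convergence. -/
lemma analyticAt_latticeSum {b : (Fin r → ℕ) → ℂ} (hb : ∀ n, ‖b n‖ ≤ 1) (hx : ∀ τ, 0 < x τ)
    (hv : ∀ i τ, 0 < v i τ) {k : ℕ} {c : TransAlg T} (hc : c ∈ augIdeal T ^ k) {s : ℂ}
    (hs : 2 * (r : ℝ) < Fintype.card T * s.re + k) :
    AnalyticAt ℂ (latticeSum b x v c) s := by
  obtain ⟨C, hC⟩ := exists_term_bound (B := ‖s‖ + 1) hx hv hc (by positivity)
  set U : Set ℂ := {z | ‖z‖ < ‖s‖ + 1} ∩ {z | 2 * (r : ℝ) < Fintype.card T * z.re + k} with hU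
  have hUo : IsOpen U := (isOpen_lt continuous_norm continuous_const).inter
    (isOpen_lt continuous_const (by fun_prop))
  have hd : DifferentiableOn ℂ (latticeSum b x v c) U := by
    refine Complex.differentiableOn_tsum_of_summable_norm ((summable_prod_inv_sq r).mul_left C)
      (fun n => ((differentiable_act_powFun c (realVec_comb_pos hx v n)).const_mul _).differentiableOn)
      hUo fun n z hz => ?_
    rw [norm_mul]
    exact (mul_le_of_le_one_left (norm_nonneg _) (hb n)).trans (hC z hz.1.le hz.2.le n)
  exact hd.analyticAt (hUo.mem_nhds ⟨by simp, hs⟩)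

lemma powFun_zero : powFun (fun _ : T => (0 : ℂ)) = fun _ => 1 := by
  ext u; simp [powFun]

lemma latticeSum_zero {b : (Fin r → ℕ) → ℂ} {c : TransAlg T} (hc : c ∈ augIdeal T) :
    latticeSum b x v c 0 = 0 := by
  simp [latticeSum, powFun_zero, act_one_eq_zero hc]

end Series

/-! ### Meromorphic continuation of the untwisted sums -/

section Scaling

variable {T : Type*} {r : ℕ}

lemma realVec_nonneg (h : T → ℝ≥0) (τ : T) : 0 ≤ realVec h τ := NNReal.coe_nonneg _

/-- The sum of the translations by `∑ εᵢ vᵢ / 2`, `εᵢ ∈ {0, 1}`. -/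
def halfSteps (v : Fin r → T → ℝ≥0) : TransAlg T :=
  ∑ ε : Fin r → Fin 2, trans ((2⁻¹ : ℝ≥0) • comb v fun i => (ε i : ℕ))

lemma halfSteps_sub_mem (v : Fin r → T → ℝ≥0) :
    halfSteps v - algebraMap ℂ (TransAlg T) (2 ^ r) ∈ augIdeal T := by
  have h1 : algebraMap ℂ (TransAlg T) (2 ^ r) = ∑ _ε : Fin r → Fin 2, (1 : TransAlg T) := by
    rw [Finset.sum_const, nsmul_one, Finset.card_univ, Fintype.card_pi_const, Fintype.card_fin,
      map_pow, map_ofNat]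
    push_cast
    rfl
  rw [halfSteps, h1, ← Finset.sum_sub_distrib]
  exact Ideal.sum_mem _ fun ε _ => trans_sub_one_mem _

/-- The correction which remains after the main term of the halving relation is removed. -/
def nextElt (x : T → ℝ≥0) (v : Fin r → T → ℝ≥0) (k : ℕ) (c : TransAlg T) : TransAlg T :=
  halve c * halfSteps v - ((2 : ℂ) ^ r / 2 ^ k) • (trans ((2⁻¹ : ℝ≥0) • x) * c)

/-- Three congruences combine: halving acts as 2^{-k} on the k-th graded piece, `halfSteps v` acts
as its augmentation 2^r, and the translation by x/2 acts as 1. -/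
lemma nextElt_mem (x : T → ℝ≥0) (v : Fin r → T → ℝ≥0) {k : ℕ} {c : TransAlg T}
    (hc : c ∈ augIdeal T ^ k) : nextElt x v k c ∈ augIdeal T ^ (k + 1) := by
  have h1 := halve_sub_mem_pow k hc
  have h2 := halfSteps_sub_mem v
  have e : nextElt x v k c = (halve c - ((2 : ℂ) ^ k)⁻¹ • c) * halfSteps v +
      ((2 : ℂ) ^ k)⁻¹ • (c * (halfSteps v - algebraMap ℂ (TransAlg T) (2 ^ r))) -
      ((2 : ℂ) ^ r / 2 ^ k) • (c * (trans ((2⁻¹ : ℝ≥0) • x) - 1)) := by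
    simp only [nextElt, Algebra.smul_def, div_eq_mul_inv, map_mul]
    ring
  rw [e]
  refine Ideal.sub_mem _ (Ideal.add_mem _ (Ideal.mul_mem_right _ _ h1) ?_) ?_
  · rw [pow_succ]
    exact Submodule.smul_of_tower_mem _ _ (Ideal.mul_mem_mul hc h2)
  · rw [pow_succ]
    exact Submodule.smul_of_tower_mem _ _ (Ideal.mul_mem_mul hc (trans_sub_one_mem _))

/-- The splitting of a tuple of naturals into halves and parities. -/
def halfEquiv (r : ℕ) : (Fin r → ℕ) ≃ (Fin r → ℕ) × (Fin r → Fin 2) :=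
  (Equiv.piCongrRight fun _ => Nat.divModEquiv 2).trans
    (Equiv.arrowProdEquivProdArrow (Fin r) (fun _ => ℕ) fun _ => Fin 2)

lemma comb_halfEquiv_symm (v : Fin r → T → ℝ≥0) (p : (Fin r → ℕ) × (Fin r → Fin 2)) :
    comb v ((halfEquiv r).symm p) = 2 • comb v p.1 + comb v fun i => (p.2 i : ℕ) := by
  rw [comb, comb, comb, Finset.smul_sum, ← Finset.sum_add_distrib]
  refine Finset.sum_congr rfl fun i _ => ?_
  have : (halfEquiv r).symm p i = 2 * p.1 i + p.2 i := by
    simp [halfEquiv, Nat.divModEquiv, mul_comm, Equiv.arrowProdEquivProdArrow]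
  rw [this, add_smul, mul_smul]

/-- The successive pairs of base point and operator in the halving relation. -/
def halvingSeq (x : T → ℝ≥0) (v : Fin r → T → ℝ≥0) : ℕ → (T → ℝ≥0) × TransAlg T
  | 0 => (x, 1)
  | k + 1 => ((2⁻¹ : ℝ≥0) • (halvingSeq x v k).1,
      nextElt (halvingSeq x v k).1 v k (halvingSeq x v k).2)

lemma halvingSeq_pos {x : T → ℝ≥0} {v : Fin r → T → ℝ≥0} (hx : ∀ τ, 0 < x τ) (k : ℕ) (τ : T) : 0 < (halvingSeq x v k).1 τ := by
  induction k with
  | zero => exact hx τ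
  | succ k ih => exact mul_pos (by positivity) ih

lemma halvingSeq_mem (x : T → ℝ≥0) (v : Fin r → T → ℝ≥0) (k : ℕ) :
    (halvingSeq x v k).2 ∈ augIdeal T ^ k := by
  induction k with
  | zero => simp [halvingSeq]
  | succ k ih => exact nextElt_mem _ _ ih

variable [Fintype T]

/-- The factor `2 ^ (-ms)` by which `∏ u_τ ^ (-s)` changes under doubling. -/
def twoPow (T : Type*) [Fintype T] (s : ℂ) : ℂ := (2 : ℂ) ^ (-(Fintype.card T * s))

lemma powFun_double (s : ℂ) {u : T → ℝ} (hu : ∀ τ, 0 ≤ u τ) :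
    powFun (fun _ => s) (u + u) = twoPow T s * powFun (fun _ => s) u := by
  have h1 : ∀ τ, (((u + u) τ : ℝ) : ℂ) ^ (-s) = (2 : ℂ) ^ (-s) * (u τ : ℂ) ^ (-s) := by
    intro τ
    have := Complex.mul_cpow_ofReal_nonneg (zero_le_two) (hu τ) (-s)
    rw [Pi.add_apply, ← two_mul]
    push_cast at this ⊢
    exact this
  rw [powFun, powFun, Finset.prod_congr rfl fun τ _ => h1 τ, Finset.prod_mul_distrib,
    Finset.prod_const, Finset.card_univ, twoPow, ← Complex.cpow_nat_mul]
  congr 2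
  ring

lemma act_powFun_double (c : TransAlg T) (s : ℂ) {u : T → ℝ} (hu : ∀ τ, 0 ≤ u τ) :
    act c (powFun fun _ => s) (u + u) = twoPow T s * act (halve c) (powFun fun _ => s) u := by
  induction c using transAlg_induction with
  | h1 h =>
    rw [halve_trans, act_trans, act_trans, ← powFun_double]
    · congr 1
      conv_lhs => rw [← half_smul_add_self h, realVec_add]
      abel
    · exact fun τ => add_nonneg (hu τ) (NNReal.coe_nonneg _)
  | h2 x y hx hy => rw [map_add halve, act_add, act_add, hx, hy, mul_add]
  | h3 a x hx => rw [map_smul halve, act_smul, act_smul, hx]; ring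

variable {x : T → ℝ≥0} {v : Fin r → T → ℝ≥0}

/-- Writing n = 2m + ε, the point x + ∑ nᵢvᵢ is twice (x/2 + ∑ mᵢvᵢ) + ∑ εᵢvᵢ/2, and homogeneity
extracts the power of 2. -/
lemma hasSum_halved {c : TransAlg T} {s S : ℂ}
    (h : HasSum (fun n => act c (powFun fun _ => s) (realVec (x + comb v n))) S) :
    HasSum (fun n => twoPow T s *
      act (halve c * halfSteps v) (powFun fun _ => s) (realVec ((2⁻¹ : ℝ≥0) • x + comb v n))) S := by
  rw [← (halfEquiv r).symm.hasSum_iff] at h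
  have h1 := h.prod_fiberwise fun n => hasSum_fintype _
  convert h1 using 2 with n
  have h2 : ∀ ε : Fin r → Fin 2, realVec (x + comb v ((halfEquiv r).symm (n, ε))) =
      realVec ((2⁻¹ : ℝ≥0) • x + comb v n + (2⁻¹ : ℝ≥0) • comb v fun i => (ε i : ℕ)) +
      realVec ((2⁻¹ : ℝ≥0) • x + comb v n + (2⁻¹ : ℝ≥0) • comb v fun i => (ε i : ℕ)) := by
    intro ε
    rw [comb_halfEquiv_symm, ← realVec_add]
    congr 1
    conv_lhs => rw [← half_smul_add_self x, ← half_smul_add_self (comb v fun i => (ε i : ℕ))]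
    rw [two_smul]
    abel
  simp only [Function.comp_apply, h2]
  rw [mul_comm (halve c), act_mul, halfSteps, act_sum, Finset.mul_sum]
  refine Finset.sum_congr rfl fun ε _ => ?_
  rw [act_powFun_double c s (realVec_nonneg _), act_trans, ← realVec_add]

/-- The halving relation between consecutive lattice sums. -/
lemma latticeSum_halving (hx : ∀ τ, 0 < x τ) (hv : ∀ i τ, 0 < v i τ) {k : ℕ} {c : TransAlg T}
    (hc : c ∈ augIdeal T ^ k) {s : ℂ} (hs : 2 * (r : ℝ) ≤ Fintype.card T * s.re + k) :
    latticeSum (fun _ => 1) x v c s =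
      twoPow T s * (latticeSum (fun _ => 1) ((2⁻¹ : ℝ≥0) • x) v (nextElt x v k c) s +
        (2 : ℂ) ^ r / 2 ^ k * latticeSum (fun _ => 1) x v c s) := by
  have hx' : ∀ τ, 0 < ((2⁻¹ : ℝ≥0) • x) τ := fun τ => mul_pos (by positivity) (hx τ)
  have h1 := hasSum_latticeSum (b := fun _ => 1) (by simp) hx hv hc hs
  have h2 := hasSum_latticeSum (b := fun _ => 1) (by simp) hx' hv (nextElt_mem x v hc) (s := s)
    (by push_cast; linarith)
  simp only [one_mul] at h1 h2
  refine (hasSum_halved h1).unique ?_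
  have e : halve c * halfSteps v =
      -- The translation by x/2 restores the base point x, so the main term is the original sum
      -- again.
      nextElt x v k c + ((2 : ℂ) ^ r / 2 ^ k) • (trans ((2⁻¹ : ℝ≥0) • x) * c) := by
    rw [nextElt, sub_add_cancel]
  have h3 : ∀ n, act (halve c * halfSteps v) (powFun fun _ => s)
      (realVec ((2⁻¹ : ℝ≥0) • x + comb v n)) =
      act (nextElt x v k c) (powFun fun _ => s) (realVec ((2⁻¹ : ℝ≥0) • x + comb v n)) +
        (2 : ℂ) ^ r / 2 ^ k * act c (powFun fun _ => s) (realVec (x + comb v n)) := by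
    intro n
    rw [e, act_add, act_smul, act_mul, act_trans, ← realVec_add, add_right_comm,
      half_smul_add_self]
  simp only [h3]
  exact (h2.add (h1.mul_left _)).mul_left _

/-- The lattice sum of the `k`-th pair of `halvingSeq`. -/
def halvingSum (x : T → ℝ≥0) (v : Fin r → T → ℝ≥0) (k : ℕ) : ℂ → ℂ :=
  latticeSum (fun _ => 1) (halvingSeq x v k).1 v (halvingSeq x v k).2

/-- `1 - 2 ^ (r - k - ms)`. -/
def eulerDenom (T : Type*) [Fintype T] (r k : ℕ) (s : ℂ) : ℂ := 1 - twoPow T s * (2 ^ r / 2 ^ k)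

/-- The continuation of the lattice sum obtained from `N` halving steps. -/
def partialZeta (x : T → ℝ≥0) (v : Fin r → T → ℝ≥0) (N : ℕ) (s : ℂ) : ℂ :=
  (∏ k ∈ Finset.range N, twoPow T s / eulerDenom T r k s) * halvingSum x v N s

lemma norm_twoPow (s : ℂ) : ‖twoPow T s‖ = (2 : ℝ) ^ (-(Fintype.card T * s.re)) := by
  rw [twoPow, ← Complex.ofReal_ofNat, Complex.norm_cpow_eq_rpow_re_of_pos two_pos]
  simp

lemma eulerDenom_ne_zero {k : ℕ} {s : ℂ} (hs : (r : ℝ) < Fintype.card T * s.re + k) :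
    eulerDenom T r k s ≠ 0 := by
  intro h
  have h1 : ‖twoPow T s * (2 ^ r / 2 ^ k)‖ = 1 := by
    rw [eulerDenom, sub_eq_zero] at h
    rw [← h, norm_one]
  rw [norm_mul, norm_twoPow, norm_div, norm_pow, norm_pow, Complex.norm_ofNat,
    ← Real.rpow_natCast, ← Real.rpow_natCast, ← Real.rpow_sub two_pos, ← Real.rpow_add two_pos] at h1
  have h2 : (2 : ℝ) ^ (-(Fintype.card T * s.re) + ((r : ℝ) - k)) < 1 :=
    Real.rpow_lt_one_of_one_lt_of_neg one_lt_two (by linarith)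
  exact h2.ne h1

/-- This is the halving relation solved for the N-th sum; its denominator is nonzero in the region
of convergence. -/
lemma partialZeta_succ (hx : ∀ τ, 0 < x τ) (hv : ∀ i τ, 0 < v i τ) {N : ℕ} {s : ℂ}
    (hs : 2 * (r : ℝ) < Fintype.card T * s.re + N) :
    partialZeta x v (N + 1) s = partialZeta x v N s := by
  have h1 := latticeSum_halving (halvingSeq_pos (v := v) hx N) hv (halvingSeq_mem x v N) hs.le
  have hr : (0 : ℝ) ≤ r := by positivity
  have h2 : eulerDenom T r N s ≠ 0 := eulerDenom_ne_zero (by linarith)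
  change halvingSum x v N s =
    twoPow T s * (halvingSum x v (N + 1) s + 2 ^ r / 2 ^ N * halvingSum x v N s) at h1
  rw [partialZeta, partialZeta, Finset.prod_range_succ, mul_assoc]
  congr 1
  rw [div_mul_eq_mul_div, div_eq_iff h2, eulerDenom]
  linear_combination -h1

lemma partialZeta_eq (hx : ∀ τ, 0 < x τ) (hv : ∀ i τ, 0 < v i τ) {M N : ℕ} {s : ℂ}
    (hM : 2 * (r : ℝ) < Fintype.card T * s.re + M) (hN : 2 * (r : ℝ) < Fintype.card T * s.re + N) :
    partialZeta x v M s = partialZeta x v N s := by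
  have key : ∀ {M N : ℕ}, 2 * (r : ℝ) < Fintype.card T * s.re + M → M ≤ N →
      partialZeta x v M s = partialZeta x v N s := by
    intro M N hM hMN
    induction N, hMN using Nat.le_induction with
    | base => rfl
    | succ N hMN ih =>
      rw [ih, partialZeta_succ hx hv]
      have : (M : ℝ) ≤ N := by exact_mod_cast hMN
      linarith
  rcases le_total M N with h | h
  · exact key hM h
  · exact (key hN h).symm

lemma differentiable_twoPow : Differentiable ℂ (twoPow T) := by
  unfold twoPow
  exact Differentiable.const_cpow (by fun_prop) (Or.inl two_ne_zero)

lemma differentiable_eulerDenom (k : ℕ) : Differentiable ℂ (eulerDenom T r k) :=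
  (differentiable_twoPow.mul_const _).const_sub 1

lemma analyticAt_halvingSum (hx : ∀ τ, 0 < x τ) (hv : ∀ i τ, 0 < v i τ) {N : ℕ} {s : ℂ}
    (hs : 2 * (r : ℝ) < Fintype.card T * s.re + N) : AnalyticAt ℂ (halvingSum x v N) s :=
  analyticAt_latticeSum (by simp) (halvingSeq_pos hx N) hv (halvingSeq_mem x v N) hs

lemma meromorphicAt_partialZeta (hx : ∀ τ, 0 < x τ) (hv : ∀ i τ, 0 < v i τ) {N : ℕ} {s : ℂ}
    (hs : 2 * (r : ℝ) < Fintype.card T * s.re + N) : MeromorphicAt (partialZeta x v N) s := by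
  refine MeromorphicAt.fun_mul ?_ (analyticAt_halvingSum hx hv hs).meromorphicAt
  refine MeromorphicAt.fun_prod fun k _ => ?_
  exact (differentiable_twoPow.analyticAt s).meromorphicAt.fun_div
    ((differentiable_eulerDenom k).analyticAt s).meromorphicAt

/-- The number of halving steps used at `s`. -/
def stepCount (T : Type*) [Fintype T] (r : ℕ) (s : ℂ) : ℕ :=
  ⌊2 * (r : ℝ) - Fintype.card T * s.re⌋₊ + 1

lemma lt_stepCount (s : ℂ) : 2 * (r : ℝ) < Fintype.card T * s.re + stepCount T r s := by
  have := Nat.lt_floor_add_one (2 * (r : ℝ) - Fintype.card T * s.re)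
  rw [stepCount]
  push_cast
  linarith

/-- The number of steps jumps with z, so local regularity is read off from a fixed number N. -/
lemma partialZeta_stepCount_eventuallyEq (hx : ∀ τ, 0 < x τ) (hv : ∀ i τ, 0 < v i τ) {N : ℕ}
    {s : ℂ} (hs : 2 * (r : ℝ) < Fintype.card T * s.re + N) :
    ∀ᶠ z in nhds s, partialZeta x v (stepCount T r z) z = partialZeta x v N z := by
  have ho : IsOpen {z : ℂ | 2 * (r : ℝ) < Fintype.card T * z.re + N} :=
    isOpen_lt continuous_const (by fun_prop)
  filter_upwards [ho.mem_nhds hs] with z hz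
  exact partialZeta_eq hx hv (lt_stepCount z) hz

lemma twoPow_zero : twoPow T 0 = 1 := by simp [twoPow]

lemma eulerDenom_zero_ne_zero {k : ℕ} (hk : k ≠ r) : eulerDenom T r k 0 ≠ 0 := by
  rw [eulerDenom, twoPow_zero, one_mul, sub_ne_zero]
  intro h
  rw [eq_div_iff (pow_ne_zero _ two_ne_zero), one_mul] at h
  have : (2 : ℕ) ^ k = 2 ^ r := by exact_mod_cast h
  exact hk (Nat.pow_right_injective le_rfl this)

lemma hasDerivAt_eulerDenom_zero :
    HasDerivAt (eulerDenom T r r) (Fintype.card T * Complex.log 2) 0 := by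
  have h1 : HasDerivAt (fun s : ℂ => -(Fintype.card T * s)) (-(Fintype.card T : ℂ)) 0 := by
    simpa using ((hasDerivAt_id' (0 : ℂ)).const_mul (Fintype.card T : ℂ)).fun_neg
  have h2 := ((h1.const_cpow (c := 2) (Or.inl two_ne_zero)).mul_const
    ((2 : ℂ) ^ r / 2 ^ r)).const_sub 1
  refine h2.congr_deriv ?_
  simp
  ring

/-- Near `0`, the partial continuation agrees with an analytic function off `0`. -/
lemma exists_analyticAt_zero_partialZeta [Nonempty T] (hx : ∀ τ, 0 < x τ)
    (hv : ∀ i τ, 0 < v i τ) :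
    ∃ g : ℂ → ℂ, AnalyticAt ℂ g 0 ∧
      ∀ᶠ z in nhdsWithin 0 {0}ᶜ, partialZeta x v (2 * r + 1) z = g z := by
  have hS := analyticAt_halvingSum hx hv (N := 2 * r + 1) (s := 0) (by simp)
  have hS0 : halvingSum x v (2 * r + 1) 0 = 0 :=
    latticeSum_zero (Ideal.pow_le_self (by omega) (halvingSeq_mem x v (2 * r + 1)))
  have hE := (differentiable_eulerDenom (T := T) (r := r) r).analyticAt 0
  have hE0 : eulerDenom T r r 0 = 0 := by simp [eulerDenom, twoPow_zero]
  have hD : dslope (eulerDenom T r r) 0 0 ≠ 0 := by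
    rw [dslope_same, hasDerivAt_eulerDenom_zero.deriv]
    refine mul_ne_zero (by exact_mod_cast Fintype.card_ne_zero) ?_
    rw [← Complex.ofReal_ofNat, ← Complex.ofReal_log zero_le_two]
    exact_mod_cast (Real.log_pos one_lt_two).ne'
  have hds : ∀ {f : ℂ → ℂ}, AnalyticAt ℂ f 0 → AnalyticAt ℂ (dslope f 0) 0 := by
    intro f hf
    obtain ⟨p, hp⟩ := hf
    exact ⟨_, hp.has_fpower_series_dslope_fslope⟩
  -- The denominator for k = r and the last lattice sum both vanish at 0; each is divided by z. The
  -- quotient of the denominator stays nonzero at 0 because its derivative there is m log 2.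
  refine ⟨fun z => (∏ k ∈ (Finset.range (2 * r + 1)).erase r, twoPow T z / eulerDenom T r k z) *
    (twoPow T z / dslope (eulerDenom T r r) 0 z) * dslope (halvingSum x v (2 * r + 1)) 0 z,
    ?_, ?_⟩
  · refine ((Finset.analyticAt_fun_prod _ fun k hk => ?_).mul ?_).mul (hds hS)
    · exact (differentiable_twoPow.analyticAt 0).fun_div
        ((differentiable_eulerDenom k).analyticAt 0)
        (eulerDenom_zero_ne_zero (Finset.ne_of_mem_erase hk))
    · exact (differentiable_twoPow.analyticAt 0).fun_div (hds hE) hD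
  · filter_upwards [self_mem_nhdsWithin] with z hz
    have hz' : z ≠ 0 := hz
    rw [partialZeta, ← Finset.prod_erase_mul _ _ (Finset.mem_range.2 (by omega : r < 2 * r + 1)),
      dslope_of_ne _ hz', dslope_of_ne _ hz', slope_def_field, slope_def_field, hE0, hS0]
    simp only [sub_zero]
    rw [mul_assoc, mul_assoc]
    congr 1
    field_simp

/-- The zeta function `∑ ∏ (x + ∑ nᵢ vᵢ)_τ ^ (-s)` has a meromorphic continuation to `ℂ` which is
analytic at `s = 0`. -/
theorem exists_continuation_untwisted [Nonempty T] (hx : ∀ τ, 0 < x τ) (hv : ∀ i τ, 0 < v i τ) :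
    ∃ Z : ℂ → ℂ, MeromorphicOn Z Set.univ ∧ AnalyticAt ℂ Z 0 ∧ ∃ σ : ℝ, ∀ s : ℂ, σ < s.re →
      HasSum (fun n => powFun (fun _ => s) (realVec (x + comb v n))) (Z s) := by
  obtain ⟨g, hg, hgz⟩ := exists_analyticAt_zero_partialZeta hx hv
  set Z : ℂ → ℂ := fun z => partialZeta x v (stepCount T r z) z with hZ
  have hZm : ∀ s, MeromorphicAt Z s := fun s =>
    (meromorphicAt_partialZeta hx hv (lt_stepCount s)).congr
      (Filter.EventuallyEq.filter_mono (Filter.EventuallyEq.symm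
        (partialZeta_stepCount_eventuallyEq hx hv (lt_stepCount s))) nhdsWithin_le_nhds)
  -- At 0 the formula contains a division by zero, so its value there is replaced by that of the
  -- analytic function.
  refine ⟨Function.update Z 0 (g 0), fun s _ => (hZm s).congr ?_, hg.congr ?_,
    2 * r, fun s hs => ?_⟩
  · rcases eq_or_ne s 0 with rfl | hs
    · filter_upwards [self_mem_nhdsWithin] with z hz
      rw [Function.update_of_ne hz]
    · refine Filter.Eventually.filter_mono nhdsWithin_le_nhds ?_
      filter_upwards [isOpen_ne.mem_nhds hs] with z hz
      rw [Function.update_of_ne hz]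
  · have h1 := partialZeta_stepCount_eventuallyEq hx hv (N := 2 * r + 1) (s := 0) (by simp)
    rw [eventually_nhdsWithin_iff] at hgz
    filter_upwards [h1, hgz] with z hz1 hz2
    rcases eq_or_ne z 0 with rfl | hz
    · simp
    · rw [Function.update_of_ne hz, hZ]
      exact ((hz1.trans (hz2 hz))).symm
  · have hr : (0 : ℝ) ≤ 2 * r := by positivity
    have hs0 : s ≠ 0 := by
      rintro rfl
      simp only [Complex.zero_re] at hs
      linarith
    have hT : (1 : ℝ) ≤ Fintype.card T := by exact_mod_cast Fintype.card_pos
    -- Here no halving step is needed, and zero steps give the original series.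
    have h2 : 2 * (r : ℝ) < Fintype.card T * s.re + (0 : ℕ) := by
      push_cast
      nlinarith
    rw [Function.update_of_ne hs0, hZ]
    simp only
    rw [partialZeta_eq hx hv (lt_stepCount s) h2]
    have h3 := hasSum_latticeSum (b := fun _ => 1) (by simp) hx hv
      (c := 1) (k := 0) (by simp) h2.le
    simpa [partialZeta, halvingSum, halvingSeq] using h3

end Scaling

/-! ### Continuation of the twisted sums -/

section Twisted

variable {T : Type*} {r : ℕ}

/-- The operator `∏ (1 - ξᵢ [vᵢ])`, inverse to summation over the lattice with the twist `ξ`. -/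
def twistElt (ξ : Fin r → ℂ) (v : Fin r → T → ℝ≥0) : TransAlg T := ∏ i, (1 - ξ i • trans (v i))

lemma act_one_sub_smul_trans (a : ℂ) (h : T → ℝ≥0) (f : (T → ℝ) → ℂ) (u : T → ℝ) :
    act (1 - a • trans h) f u = f u - a * f (u + realVec h) := by
  rw [act_sub, act_smul, act_trans, map_one]
  rfl

lemma comb_add_single (v : Fin r → T → ℝ≥0) (n : Fin r → ℕ) (i : Fin r) :
    comb v (n + Pi.single i 1) = comb v n + v i := by
  classical
  simp only [comb, Pi.add_apply, add_smul, Finset.sum_add_distrib]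
  congr 1
  rw [Finset.sum_eq_single i]
  · simp
  · intro j _ hj; simp [Pi.single_eq_of_ne hj]
  · simp

lemma comb_cons (v : Fin (r + 1) → T → ℝ≥0) (m : ℕ) (n : Fin r → ℕ) :
    comb v (Fin.cons m n : Fin (r + 1) → ℕ) = m • v 0 + comb (fun i => v i.succ) n := by
  simp [comb, Fin.sum_univ_succ]

/-- Each factor adds a multiple of a shifted subfamily, which is again absolutely summable. -/
lemma summable_act_prod (ξ : Fin r → ℂ) (v : Fin r → T → ℝ≥0) (f : (T → ℝ) → ℂ) (u : T → ℝ)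
    (hf : Summable fun n => ‖f (u + realVec (comb v n))‖) (s : Finset (Fin r)) :
    Summable fun n => ‖act (∏ i ∈ s, (1 - ξ i • trans (v i))) f (u + realVec (comb v n))‖ := by
  classical
  induction s using Finset.induction_on with
  | empty => simpa using hf
  | insert i s hi ih =>
    rw [Finset.prod_insert hi]
    set g := act (∏ i ∈ s, (1 - ξ i • trans (v i))) f with hg
    have h1 : Summable fun n => ‖g (u + realVec (comb v (n + Pi.single i 1)))‖ :=
      ih.comp_injective (i := fun n : Fin r → ℕ => n + Pi.single i 1)
        fun a b hab => add_right_cancel hab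
    refine Summable.of_nonneg_of_le (fun _ => norm_nonneg _) (fun n => ?_)
      (ih.add (h1.mul_left ‖ξ i‖))
    rw [act_mul, act_one_sub_smul_trans, comb_add_single, realVec_add, ← add_assoc]
    refine (norm_sub_le _ _).trans (add_le_add le_rfl ?_)
    rw [norm_mul]

/-- Summation over the lattice with the twist `ξ` inverts `∏ (1 - ξᵢ [vᵢ])`. -/
lemma hasSum_twistElt (ξ : Fin r → ℂ) (hξ : ∀ i, ‖ξ i‖ ≤ 1) (v : Fin r → T → ℝ≥0)
    (f : (T → ℝ) → ℂ) (u : T → ℝ) (hf : Summable fun n => ‖f (u + realVec (comb v n))‖) :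
    HasSum (fun n : Fin r → ℕ => (∏ i, ξ i ^ n i) *
      act (twistElt ξ v) f (u + realVec (comb v n))) (f u) := by
  induction r generalizing f u with
  | zero =>
    simp [twistElt, comb]
  | succ r ih =>
    set v' : Fin r → T → ℝ≥0 := fun i => v i.succ with hv'
    set ξ' : Fin r → ℂ := fun i => ξ i.succ with hξ'
    set f' := act (1 - ξ 0 • trans (v 0)) f with hf'
    -- Absolute convergence gives some sum S; it is then computed fibrewise over the first index,
    -- where the induction hypothesis leaves a telescoping series.
    have hsum : Summable fun n : Fin (r + 1) → ℕ => (∏ i, ξ i ^ n i) *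
        act (twistElt ξ v) f (u + realVec (comb v n)) := by
      refine Summable.of_norm_bounded (summable_act_prod ξ v f u hf Finset.univ) fun n => ?_
      rw [norm_mul, norm_prod]
      refine mul_le_of_le_one_left (norm_nonneg _) (Finset.prod_le_one
        (fun _ _ => norm_nonneg _) fun i _ => ?_)
      rw [norm_pow]
      exact pow_le_one₀ (norm_nonneg _) (hξ i)
    obtain ⟨S, hS⟩ := hsum
    have hS' := hS
    rw [← (Fin.consEquiv fun _ : Fin (r + 1) => ℕ).hasSum_iff] at hS'
    have hcomb : ∀ m n, u + realVec (comb v (Fin.cons m n : Fin (r + 1) → ℕ)) =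
        (u + m • realVec (v 0)) + realVec (comb v' n) := by
      intro m n
      rw [comb_cons, realVec_add, realVec_nsmul, add_assoc]
    have hf1 : Summable fun n => ‖f' (u + realVec (comb v n))‖ := by
      have := summable_act_prod ξ v f u hf {0}
      simpa only [Finset.prod_singleton] using this
    have hfib : ∀ m : ℕ, HasSum (fun n : Fin r → ℕ => ξ 0 ^ m * ((∏ i, ξ' i ^ n i) *
        act (twistElt ξ' v') f' ((u + m • realVec (v 0)) + realVec (comb v' n))))
        (ξ 0 ^ m * f' (u + m • realVec (v 0))) := by
      intro m
      refine (ih ξ' (fun i => hξ _) v' f' _ ?_).mul_left _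
      have := hf1.comp_injective (i := fun n : Fin r → ℕ => (Fin.cons m n : Fin (r + 1) → ℕ))
        (fun a b hab => (Fin.cons_injective2 hab).2)
      refine this.congr fun n => ?_
      simp only [Function.comp_apply, hcomb]
    have h2 := hS'.prod_fiberwise (g := fun m => ξ 0 ^ m * f' (u + m • realVec (v 0))) (by
      intro m
      convert hfib m using 2 with n
      have e : twistElt ξ v = twistElt ξ' v' * (1 - ξ 0 • trans (v 0)) := by
        rw [twistElt, Fin.prod_univ_succ, mul_comm]
        rfl
      have e2 : (Fin.consEquiv fun _ : Fin (r + 1) => ℕ) (m, n) = Fin.cons m n := rfl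
      rw [Function.comp_apply, e2, e, act_mul, hcomb, Fin.prod_univ_succ]
      simp only [Fin.cons_zero, Fin.cons_succ]
      ring)
    set A : ℕ → ℂ := fun m => ξ 0 ^ m * f (u + m • realVec (v 0)) with hA
    have hAs : Summable A := by
      have := hf.comp_injective (i := fun m : ℕ => (Fin.cons m 0 : Fin (r + 1) → ℕ))
        (fun a b hab => by simpa using congrFun hab 0)
      refine Summable.of_norm_bounded this fun m => ?_
      rw [norm_mul, norm_pow, Function.comp_apply, hcomb]
      have e : realVec (comb v' 0) = 0 := by simp [comb]
      rw [e, add_zero]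
      exact mul_le_of_le_one_left (norm_nonneg _) (pow_le_one₀ (norm_nonneg _) (hξ 0))
    have h3 : HasSum (fun m => A m - A (m + 1)) (A 0) := by
      obtain ⟨a, ha⟩ := hAs
      have h4 := (hasSum_nat_add_iff' 1).2 ha
      simpa using ha.sub h4
    have h5 : (fun m => ξ 0 ^ m * f' (u + m • realVec (v 0))) = fun m => A m - A (m + 1) := by
      funext m
      simp only [hA, hf', act_one_sub_smul_trans, add_smul, one_smul, pow_succ, ← add_assoc]
      ring
    rw [h5] at h2
    have h6 : S = f u := by
      rw [h2.unique h3]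
      simp [hA]
    rwa [← h6]

lemma twistElt_sub_mem (ξ : Fin r → ℂ) (v : Fin r → T → ℝ≥0) :
    twistElt ξ v - algebraMap ℂ (TransAlg T) (∏ i, (1 - ξ i)) ∈ augIdeal T := by
  rw [← Ideal.Quotient.mk_eq_mk_iff_sub_mem, twistElt, map_prod, map_prod, map_prod]
  refine Finset.prod_congr rfl fun i _ => ?_
  rw [Ideal.Quotient.mk_eq_mk_iff_sub_mem]
  have : (1 - ξ i • trans (v i)) - algebraMap ℂ (TransAlg T) (1 - ξ i) =
      (-ξ i) • (trans (v i) - 1) := by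
    simp only [Algebra.smul_def, map_sub, map_neg, map_one]
    ring
  rw [this]
  exact Submodule.smul_of_tower_mem _ _ (trans_sub_one_mem _)

/-- `∏ (1 - ξᵢ [vᵢ])` is invertible modulo every power of the augmentation ideal. -/
lemma exists_twist_inverse (ξ : Fin r → ℂ) (hξ : ∀ i, ξ i ≠ 1) (v : Fin r → T → ℝ≥0) (N : ℕ) :
    ∃ e : TransAlg T, 1 - twistElt ξ v * e ∈ augIdeal T ^ N := by
  set p : ℂ := ∏ i, (1 - ξ i) with hp
  have hp0 : p ≠ 0 := Finset.prod_ne_zero_iff.2 fun i _ => sub_ne_zero.2 (hξ i).symm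
  set y : TransAlg T := 1 - p⁻¹ • twistElt ξ v with hy
  have hy1 : y ∈ augIdeal T := by
    have := Submodule.smul_of_tower_mem (augIdeal T) (-p⁻¹) (twistElt_sub_mem ξ v)
    convert this using 1
    rw [hy, ← hp, smul_sub, neg_smul, neg_smul, Algebra.algebraMap_eq_smul_one, smul_smul,
      inv_mul_cancel₀ hp0, one_smul]
    ring
  refine ⟨p⁻¹ • ∑ j ∈ Finset.range N, y ^ j, ?_⟩
  have h1 : twistElt ξ v * (p⁻¹ • ∑ j ∈ Finset.range N, y ^ j) = 1 - y ^ N := by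
    -- A truncated geometric series: the operator divided by its augmentation p is 1 - y with y in
    -- the augmentation ideal.
    rw [← mul_neg_geom_sum, mul_smul_comm, ← smul_mul_assoc]
    congr 1
    rw [hy, sub_sub_cancel]
  rw [h1, sub_sub_cancel]
  exact Ideal.pow_mem_pow hy1 N

variable [Fintype T] {x : T → ℝ≥0} {v : Fin r → T → ℝ≥0}

/-- The twisted zeta function `∑ ξ^n ∏ (x + ∑ nᵢ vᵢ)_τ ^ (-s)`, with all `ξᵢ ≠ 1`, continues
analytically beyond `s = 0`, and its value there is `∏ (1 - ξᵢ)⁻¹`. -/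
theorem exists_continuation_twisted [Nonempty T] (hx : ∀ τ, 0 < x τ) (hv : ∀ i τ, 0 < v i τ)
    (ξ : Fin r → ℂ) (hξ : ∀ i, ‖ξ i‖ ≤ 1) (hξ1 : ∀ i, ξ i ≠ 1) :
    ∃ Z : ℂ → ℂ, (∀ s : ℂ, -1 < Fintype.card T * s.re → AnalyticAt ℂ Z s) ∧
      Z 0 = ∏ i, (1 - ξ i)⁻¹ ∧ ∃ σ : ℝ, ∀ s : ℂ, σ < s.re →
      HasSum (fun n : Fin r → ℕ => (∏ i, ξ i ^ n i) *
        powFun (fun _ => s) (realVec (x + comb v n))) (Z s) := by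
  -- Order 2r + 1 makes the remainder sum converge for m Re s > -1, a half-plane containing 0.
  obtain ⟨e, he⟩ := exists_twist_inverse ξ hξ1 v (2 * r + 1)
  set d := 1 - twistElt ξ v * e with hd
  have hb : ∀ n : Fin r → ℕ, ‖∏ i, ξ i ^ n i‖ ≤ 1 := fun n => by
    rw [norm_prod]
    refine Finset.prod_le_one (fun _ _ => norm_nonneg _) fun i _ => ?_
    rw [norm_pow]
    exact pow_le_one₀ (norm_nonneg _) (hξ i)
  refine ⟨fun s => act e (powFun fun _ => s) (realVec x) +
    latticeSum (fun n => ∏ i, ξ i ^ n i) x v d s, fun s hs => ?_, ?_, 2 * r, fun s hs => ?_⟩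
  · refine ((differentiable_act_powFun e (fun τ => ?_)).analyticAt s).add
      (analyticAt_latticeSum hb hx hv he ?_)
    · exact hx τ
    · push_cast
      linarith
  · simp only
    rw [latticeSum_zero (Ideal.pow_le_self (by omega) he), add_zero, powFun_zero]
    -- On constants the twist operator is multiplication by ∏ (1 - ξᵢ), so e must send 1 to the
    -- inverse of this product.
    have h1 : act (twistElt ξ v * e) (fun _ => (1 : ℂ)) = fun _ => 1 := by
      have h2 := act_one_eq_zero (Ideal.pow_le_self (by omega) he)
      rw [hd, map_sub, map_one, LinearMap.sub_apply, sub_eq_zero] at h2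
      exact h2.symm
    have h3 : act (twistElt ξ v) (fun _ => (1 : ℂ)) = fun _ => ∏ i, (1 - ξ i) := by
      have h4 := act_one_eq_zero (twistElt_sub_mem ξ v)
      rw [map_sub, LinearMap.sub_apply, sub_eq_zero, Algebra.algebraMap_eq_smul_one, map_smul,
        map_one] at h4
      rw [h4]
      funext u
      simp
    rw [mul_comm, act_mul, h3] at h1
    have h5 : (fun _ : T → ℝ => ∏ i, (1 - ξ i)) = (∏ i, (1 - ξ i)) • fun _ : T → ℝ => (1 : ℂ) := by
      funext u; simp
    rw [h5, map_smul] at h1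
    have h6 := congrFun h1 (realVec x)
    rw [Pi.smul_apply, smul_eq_mul] at h6
    rw [Finset.prod_inv_distrib]
    exact eq_inv_of_mul_eq_one_right h6
  · have hT : (1 : ℝ) ≤ Fintype.card T := by exact_mod_cast Fintype.card_pos
    have hr : (0 : ℝ) ≤ 2 * r := by positivity
    have h2 : 2 * (r : ℝ) ≤ Fintype.card T * s.re := by nlinarith
    have h3 := hasSum_latticeSum (s := s) hb hx hv he (by push_cast; linarith)
    have h4 := hasSum_twistElt ξ hξ v (act e (powFun fun _ => s)) (realVec x) (by
      have := summable_term hx hv (c := e) (k := 0) (s := s) (by simp) (by simpa using h2)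
      simpa only [realVec_add] using this)
    have h5 := h4.add h3
    have h6 : ∀ n : Fin r → ℕ, (∏ i, ξ i ^ n i) *
        powFun (fun _ => s) (realVec (x + comb v n)) =
        (∏ i, ξ i ^ n i) *
          act (twistElt ξ v) (act e (powFun fun _ => s)) (realVec x + realVec (comb v n)) +
        (∏ i, ξ i ^ n i) * act d (powFun fun _ => s) (realVec (x + comb v n)) := by
      intro n
      rw [← mul_add, ← act_mul, ← realVec_add, ← act_add, hd, add_sub_cancel, map_one]
      rfl
    simp only [h6]
    exact h5

end Twisted

/-! ### Cones in `F ⊗ ℝ` and lattice points in them -/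

section Cones

variable {F : Type*} [Field F]

lemma embed_add (x y : F) : embed (x + y) = embed x + embed y := by
  ext τ; simp [embed]

lemma embed_sum {κ : Type*} (s : Finset κ) (f : κ → F) :
    embed (∑ i ∈ s, f i) = ∑ i ∈ s, embed (f i) := by
  ext τ; simp [embed]

lemma embed_natCast_mul (n : ℕ) (x : F) : embed ((n : F) * x) = (n : ℝ) • embed x := by
  ext τ; simp [embed]

/-- In a totally real field, complex embeddings come from real ones. -/
lemma exists_real_embedding [NumberField.IsTotallyReal F] (φ : F →+* ℂ) :
    ∃ τ : F →+* ℝ, ∀ x, ((τ x : ℝ) : ℂ) = φ x :=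
  ⟨_, (NumberField.IsTotallyReal.complexEmbedding_isReal φ).coe_embedding_apply⟩

/-- A decomposition for which η is good need not be given with totally positive generators. Each vᵢ
is the limit of the cone points vᵢ + ε ∑ vₗ, hence nonnegative at every τ, and injectivity of τ
excludes 0. -/
lemma totallyPositive_of_cone_pos {r : ℕ} {v : Fin r → 𝓞 F} (hv : ∀ i, v i ≠ 0)
    (h : ∀ y ∈ cone v, ∀ τ, 0 < y τ) (i : Fin r) (τ : F →+* ℝ) : 0 < τ (v i : F) := by
  have h1 : ∀ ε : ℝ, 0 < ε → 0 < τ (v i : F) + ε * ∑ l, τ (v l : F) := by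
    intro ε hε
    have h2 := h (∑ l, ((if l = i then 1 else 0) + ε) • embed (v l : F))
      ⟨fun l => (if l = i then 1 else 0) + ε, fun l => by positivity, rfl⟩ τ
    simp only [Finset.sum_apply, Pi.smul_apply, smul_eq_mul, embed, add_mul,
      Finset.sum_add_distrib, ite_mul, one_mul, zero_mul, Finset.sum_ite_eq', Finset.mem_univ,
      if_true] at h2
    rwa [Finset.mul_sum]
  have h3 : 0 ≤ τ (v i : F) := by
    by_contra hneg
    push Not at hneg
    set a := τ (v i : F)
    set b := ∑ l, τ (v l : F)
    have hb : 0 < |b| + 1 := by positivity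
    have h4 := h1 (-a / (|b| + 1)) (div_pos (by linarith) hb)
    have h5 : 0 < a * (|b| + 1) + -a * b := by
      have := mul_pos h4 hb
      field_simp at this
      linarith
    nlinarith [le_abs_self b, neg_abs_le b]
  refine lt_of_le_of_ne h3 fun h4 => hv i ?_
  have h5 : ((v i : 𝓞 F) : F) = 0 := by
    rwa [eq_comm, map_eq_zero] at h4
  exact_mod_cast h5

/-- The points of `S` in the half-open fundamental box of the cone spanned by the `M vᵢ`. -/
def boxReps (S : Set F) (M : ℕ) {r : ℕ} (v : Fin r → 𝓞 F) : Set F :=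
  {x | x ∈ S ∧ ∃ t : Fin r → ℝ, (∀ i, 0 < t i ∧ t i ≤ 1) ∧
    embed x = ∑ i, t i • embed ((M : F) * (v i : F))}

/-- The translate of `x` by `M ∑ nᵢ vᵢ`. -/
def shift (M : ℕ) {r : ℕ} (v : Fin r → 𝓞 F) (x : F) (n : Fin r → ℕ) : F :=
  x + (M : F) * ((∑ i, (n i : 𝓞 F) * v i : 𝓞 F) : F)

lemma embed_shift (M : ℕ) {r : ℕ} (v : Fin r → 𝓞 F) (x : F) (n : Fin r → ℕ) :
    embed (shift M v x n) = embed x + ∑ i, (n i : ℝ) • embed ((M : F) * (v i : F)) := by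
  rw [shift, embed_add, NumberField.RingOfIntegers.coe_eq_algebraMap, map_sum, Finset.mul_sum,
    embed_sum]
  congr 1
  refine Finset.sum_congr rfl fun i _ => ?_
  rw [← embed_natCast_mul, map_mul, map_natCast]
  congr 1
  ring

lemma mem_cone_iff {r : ℕ} {v : Fin r → 𝓞 F} {M : ℕ} (hM : 0 < M) {y : (F →+* ℝ) → ℝ} :
    y ∈ cone v ↔ ∃ t : Fin r → ℝ, (∀ i, 0 < t i) ∧ y = ∑ i, t i • embed ((M : F) * (v i : F)) := by
  have hM' : (0 : ℝ) < M := by exact_mod_cast hM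
  constructor
  · rintro ⟨t, ht, rfl⟩
    refine ⟨fun i => t i / M, fun i => div_pos (ht i) hM', Finset.sum_congr rfl fun i _ => ?_⟩
    rw [embed_natCast_mul, smul_smul, div_mul_cancel₀ _ hM'.ne']
  · rintro ⟨t, ht, rfl⟩
    refine ⟨fun i => t i * M, fun i => mul_pos (ht i) hM', Finset.sum_congr rfl fun i _ => ?_⟩
    rw [embed_natCast_mul, smul_smul]

lemma boxReps_subset_cone {S : Set F} {M : ℕ} (hM : 0 < M) {r : ℕ} {v : Fin r → 𝓞 F} {x : F}
    (hx : x ∈ boxReps S M v) : embed x ∈ cone v := by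
  obtain ⟨-, t, ht, e⟩ := hx
  exact (mem_cone_iff hM).2 ⟨t, fun i => (ht i).1, e⟩

lemma shift_mem_cone {M : ℕ} (hM : 0 < M) {r : ℕ} {v : Fin r → 𝓞 F} {x : F}
    (hx : embed x ∈ cone v) (n : Fin r → ℕ) : embed (shift M v x n) ∈ cone v := by
  obtain ⟨t, ht, e⟩ := (mem_cone_iff hM).1 hx
  refine (mem_cone_iff hM).2 ⟨fun i => t i + n i, fun i => ?_, ?_⟩
  · have := ht i
    positivity
  · rw [embed_shift, e, ← Finset.sum_add_distrib]
    exact Finset.sum_congr rfl fun i _ => (add_smul _ _ _).symm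

lemma exists_shift_eq {M : ℕ} (hM : 0 < M) {r : ℕ} {v : Fin r → 𝓞 F} {z : F}
    (hz : embed z ∈ cone v) : ∃ x n, (∃ t : Fin r → ℝ, (∀ i, 0 < t i ∧ t i ≤ 1) ∧
      embed x = ∑ i, t i • embed ((M : F) * (v i : F))) ∧ shift M v x n = z := by
  obtain ⟨t, ht, e⟩ := (mem_cone_iff hM).1 hz
  -- The box is closed at 1 and open at 0, so the integral part is ⌈t⌉ - 1, a natural number because
  -- t > 0.
  set n : Fin r → ℕ := fun i => ⌈t i⌉₊ - 1 with hn
  have hn' : ∀ i, (n i : ℝ) = ⌈t i⌉₊ - 1 := fun i => by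
    have : 1 ≤ ⌈t i⌉₊ := Nat.one_le_ceil_iff.2 (ht i)
    rw [hn]
    push_cast [this]
    rfl
  refine ⟨z - (M : F) * ((∑ i, (n i : 𝓞 F) * v i : 𝓞 F) : F), n,
    ⟨fun i => t i - n i, fun i => ?_, ?_⟩, by rw [shift, sub_add_cancel]⟩
  · have h1 := Nat.ceil_lt_add_one (ht i).le
    have h2 := Nat.le_ceil (t i)
    simp only [hn' i]
    constructor <;> linarith
  · have h3 := embed_shift M v (z - (M : F) * ((∑ i, (n i : 𝓞 F) * v i : 𝓞 F) : F)) n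
    rw [shift, sub_add_cancel, e] at h3
    rw [← sub_eq_iff_eq_add] at h3
    rw [← h3, ← Finset.sum_sub_distrib]
    exact Finset.sum_congr rfl fun i _ => (sub_smul _ _ _).symm

lemma shift_injective {M : ℕ} {r : ℕ} {v : Fin r → 𝓞 F}
    (hli : LinearIndependent ℝ fun i => embed ((M : F) * (v i : F))) {S : Set F} {x y : F}
    (hx : x ∈ boxReps S M v) (hy : y ∈ boxReps S M v) {m n : Fin r → ℕ}
    (h : shift M v x m = shift M v y n) : x = y ∧ m = n := by
  obtain ⟨-, t, ht, ex⟩ := hx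
  obtain ⟨-, u, hu, ey⟩ := hy
  have h1 := congrArg embed h
  rw [embed_shift, embed_shift, ex, ey, ← Finset.sum_add_distrib, ← Finset.sum_add_distrib] at h1
  simp only [← add_smul] at h1
  have h2 : ∀ i, t i + m i = u i + n i := by
    have := Fintype.linearIndependent_iff.1 hli (fun i => (t i + m i) - (u i + n i)) (by
      simp only [sub_smul, Finset.sum_sub_distrib, h1, sub_self])
    exact fun i => sub_eq_zero.1 (this i)
  have h3 : m = n := by
    funext i
    have h4 := h2 i
    have h5 := ht i
    have h6 := hu i
    have h7 : (m i : ℝ) < n i + 1 := by linarith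
    have h8 : (n i : ℝ) < m i + 1 := by linarith
    have h7' : m i < n i + 1 := by exact_mod_cast h7
    have h8' : n i < m i + 1 := by exact_mod_cast h8
    omega
  refine ⟨?_, h3⟩
  rw [h3, shift, shift] at h
  exact add_right_cancel h

/-- Sums over the points of a periodic set in a cone, by classes modulo the period. -/
lemma hasSum_cone {M : ℕ} (hM : 0 < M) {r : ℕ} {v : Fin r → 𝓞 F}
    (hli : LinearIndependent ℝ fun i => embed ((M : F) * (v i : F))) {S : Set F}
    (hper : ∀ (x : F) (n : Fin r → ℕ), embed x ∈ cone v → (x ∈ S ↔ shift M v x n ∈ S))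
    (hfin : (boxReps S M v).Finite) (f a : F → ℂ)
    (ha : ∀ x ∈ boxReps S M v, HasSum (fun n => f (shift M v x n)) (a x)) :
    HasSum (f ∘ (Subtype.val : {z | z ∈ S ∧ embed z ∈ cone v} → F)) (∑ x ∈ hfin.toFinset, a x) := by
  have hset : {z | z ∈ S ∧ embed z ∈ cone v} =
      ⋃ x ∈ hfin.toFinset, Set.range (shift M v x) := by
    ext z
    simp only [Set.mem_iUnion, Set.Finite.mem_toFinset, Set.mem_range, Set.mem_ofPred_eq,
      exists_prop]
    constructor
    · rintro ⟨hzS, hzc⟩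
      obtain ⟨x, n, ⟨t, ht, e⟩, rfl⟩ := exists_shift_eq hM hzc
      have hxc : embed x ∈ cone v := (mem_cone_iff hM).2 ⟨t, fun i => (ht i).1, e⟩
      exact ⟨x, ⟨(hper x n hxc).2 hzS, t, ht, e⟩, n, rfl⟩
    · rintro ⟨x, hx, n, rfl⟩
      have hxc := boxReps_subset_cone hM hx
      exact ⟨(hper x n hxc).1 hx.1, shift_mem_cone hM hxc n⟩
  rw [hset]
  refine hasSum_sum_disjoint _ ?_ fun x hx => ?_
  · intro x hx y hy hxy
    rw [Function.onFun, Set.disjoint_left]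
    rintro z ⟨m, rfl⟩ ⟨n, hn⟩
    exact hxy (shift_injective hli (hfin.mem_toFinset.1 hx) (hfin.mem_toFinset.1 hy) hn.symm).1
  · have hx' := hfin.mem_toFinset.1 hx
    have hinj : Function.Injective (shift M v x) := fun m n h => (shift_injective hli hx' hx' h).2
    exact (hinj.hasSum_range_iff (f := f)).2 (ha x hx')

variable [NumberField F]

/-- The square of the determinant of the embedding matrix is the discriminant of the basis, which is
nonzero; total reality identifies its columns with the real embeddings. -/
lemma linearIndependent_embed_basis [NumberField.IsTotallyReal F] {J : Type*} [Fintype J]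
    (b : Module.Basis J ℚ F) : LinearIndependent ℝ fun j => embed (b j) := by
  classical
  rw [Fintype.linearIndependent_iff]
  intro t ht
  have hcard : Fintype.card J = Fintype.card (F →ₐ[ℚ] ℂ) := by
    rw [AlgHom.card, Module.finrank_eq_card_basis b]
  set e : J ≃ (F →ₐ[ℚ] ℂ) := Fintype.equivOfCardEq hcard
  have hdet : (Algebra.embeddingsMatrixReindex ℚ ℂ b e).det ≠ 0 := by
    intro h
    have h1 := Algebra.discr_eq_det_embeddingsMatrixReindex_pow_two ℚ ℂ b e
    rw [h, zero_pow two_ne_zero] at h1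
    exact Algebra.discr_not_zero_of_basis ℚ b (by simpa using h1)
  have h2 : Matrix.vecMul (fun j => (t j : ℂ)) (Algebra.embeddingsMatrixReindex ℚ ℂ b e) = 0 := by
    ext j
    obtain ⟨τ, hτ⟩ := exists_real_embedding (e j : F →+* ℂ)
    have h3 := congrArg (fun a : ℝ => (a : ℂ)) (congrFun ht τ)
    simp only [Finset.sum_apply, Pi.smul_apply, embed, smul_eq_mul, Complex.ofReal_sum,
      Complex.ofReal_mul, hτ, Pi.zero_apply, Complex.ofReal_zero] at h3
    simpa [Matrix.vecMul, dotProduct, Algebra.embeddingsMatrixReindex] using h3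
  intro j
  have h4 := congrFun (Matrix.eq_zero_of_vecMul_eq_zero hdet h2) j
  simpa using h4

lemma linearIndependent_embed [NumberField.IsTotallyReal F] {J : Type*} {v : J → F}
    (hv : LinearIndependent ℚ v) : LinearIndependent ℝ fun j => embed (v j) := by
  have h0 : LinearIndepOn ℚ id (Set.range v) := hv.linearIndepOn_id
  set b := Module.Basis.extend h0 with hb
  have : Fintype (h0.extend (Set.subset_univ _)) := FiniteDimensional.fintypeBasisIndex b
  have h1 := linearIndependent_embed_basis b
  have h2 := h1.comp (fun j => ⟨v j, h0.subset_extend (Set.subset_univ _) ⟨j, rfl⟩⟩) (by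
    intro i j hij
    exact hv.injective (by simpa using hij))
  convert h2 using 2 with j
  rw [Function.comp_apply, hb, Module.Basis.extend_apply_self]

/-- Bounded subsets of a fractional ideal are finite. -/
lemma finite_fractionalIdeal_bounded [NumberField.IsTotallyReal F]
    (I : FractionalIdeal (𝓞 F)⁰ F) (B : ℝ) :
    {x : F | x ∈ I ∧ ∀ τ : F →+* ℝ, |τ x| ≤ B}.Finite := by
  obtain ⟨d, hd, hI⟩ := I.isFractional
  have hd0 : ((d : 𝓞 F) : F) ≠ 0 := by
    have := nonZeroDivisors.ne_zero hd
    exact_mod_cast this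
  -- After multiplication by the denominator d, the elements are integers with all conjugates
  -- bounded by B'.
  set B' : ℝ := ∑ φ : F →+* ℂ, ‖φ (d : F)‖ * B with hB'
  have hfin := NumberField.Embeddings.finite_of_norm_le F ℂ B'
  refine Set.Finite.subset (hfin.preimage (f := fun x : F => (d : F) * x)
    (mul_right_injective₀ hd0).injOn) ?_
  rintro x ⟨hxI, hxB⟩
  obtain ⟨y, hy⟩ := hI x hxI
  refine ⟨?_, fun φ => ?_⟩
  · have : (d : F) * x = algebraMap (𝓞 F) F y := by rw [hy, Algebra.smul_def]
    change IsIntegral ℤ ((d : F) * x)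
    rw [this]
    exact y.isIntegral_coe
  · obtain ⟨τ, hτ⟩ := exists_real_embedding φ
    have h1 : ∀ φ : F →+* ℂ, ‖φ x‖ ≤ B := by
      intro φ
      obtain ⟨τ, hτ⟩ := exists_real_embedding φ
      rw [← hτ, Complex.norm_real]
      exact hxB τ
    have hB0 : 0 ≤ B := (norm_nonneg _).trans (h1 φ)
    rw [map_mul, norm_mul]
    refine (mul_le_mul_of_nonneg_left (h1 φ) (norm_nonneg _)).trans ?_
    exact Finset.single_le_sum (f := fun φ : F →+* ℂ => ‖φ (d : F)‖ * B)
      (fun _ _ => by positivity) (Finset.mem_univ φ)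

lemma finite_boxReps [NumberField.IsTotallyReal F] {S : Set F} {I : FractionalIdeal (𝓞 F)⁰ F}
    (hS : ∀ x ∈ S, x ∈ I) (M : ℕ) {r : ℕ} (v : Fin r → 𝓞 F) : (boxReps S M v).Finite := by
  refine (finite_fractionalIdeal_bounded I
    (∑ τ : F →+* ℝ, ∑ i, |τ ((M : F) * (v i : F))|)).subset ?_
  rintro x ⟨hxS, t, ht, e⟩
  refine ⟨hS x hxS, fun τ => ?_⟩
  have h1 : τ x = ∑ i, t i * τ ((M : F) * (v i : F)) := by
    simpa [embed] using congrFun e τ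
  have h2 : |τ x| ≤ ∑ i, |τ ((M : F) * (v i : F))| := by
    rw [h1]
    refine (Finset.abs_sum_le_sum_abs _ _).trans (Finset.sum_le_sum fun i _ => ?_)
    rw [abs_mul, abs_of_pos (ht i).1]
    exact mul_le_of_le_one_left (abs_nonneg _) (ht i).2
  exact h2.trans (Finset.single_le_sum
    (f := fun τ : F →+* ℝ => ∑ i, |τ ((M : F) * (v i : F))|) (fun _ _ => by positivity)
    (Finset.mem_univ τ))

/-- Sums over the points of a periodic set in a finite disjoint union of cones. -/
lemma hasSum_coneDecomposition [NumberField.IsTotallyReal F]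
    {D : Set ((F →+* ℝ) → ℝ)} {k : ℕ} {r : Fin k → ℕ} {v : ∀ j, Fin (r j) → 𝓞 F}
    (hdec : IsConeDecomposition D r v) {M : ℕ} (hM : 0 < M) {S : Set F}
    (hper : ∀ (j : Fin k) (x : F) (n : Fin (r j) → ℕ), embed x ∈ cone (v j) →
      (x ∈ S ↔ shift M (v j) x n ∈ S))
    (hfin : ∀ j, (boxReps S M (v j)).Finite) (f : F → ℂ) (a : Fin k → F → ℂ)
    (ha : ∀ j, ∀ x ∈ boxReps S M (v j), HasSum (fun n => f (shift M (v j) x n)) (a j x)) :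
    HasSum (f ∘ (Subtype.val : {z | z ∈ S ∧ embed z ∈ D} → F))
      (∑ j, ∑ x ∈ (hfin j).toFinset, a j x) := by
  obtain ⟨-, hli, hdisj, rfl⟩ := hdec
  have hset : {z | z ∈ S ∧ embed z ∈ ⋃ j, cone (v j)} =
      ⋃ j ∈ (Finset.univ : Finset (Fin k)), {z | z ∈ S ∧ embed z ∈ cone (v j)} := by
    ext z
    simp
  rw [hset]
  refine hasSum_sum_disjoint _ ?_ fun j _ => ?_
  · intro i _ j _ hij
    rw [Function.onFun, Set.disjoint_left]
    rintro z ⟨-, hi⟩ ⟨-, hj⟩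
    exact Set.disjoint_left.1 (hdisj hij) hi hj
  · refine hasSum_cone hM ?_ (hper j) (hfin j) f (a j) (ha j)
    have hM0 : (M : ℝ) ≠ 0 := by exact_mod_cast hM.ne'
    have h1 := (linearIndependent_embed (hli j)).units_smul fun _ => Units.mk0 (M : ℝ) hM0
    convert h1 using 2 with i
    rw [embed_natCast_mul]
    rfl

end Cones

/-! ### Zeta functions of periodic subsets of Shintani sets -/

section PeriodicZeta

variable {F : Type*} [Field F] {T : Type*}

/-- The vector of the images of `z` under the embeddings `e t`, as nonnegative reals. -/
def posVec (e : T → F →+* ℝ) (z : F) : T → ℝ≥0 := fun t => (e t z).toNNReal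

lemma cone_pos {r : ℕ} {v : Fin r → 𝓞 F} (hr : 0 < r) (hv : ∀ i (τ : F →+* ℝ), 0 < τ (v i : F))
    {y : (F →+* ℝ) → ℝ} (hy : y ∈ cone v) (τ : F →+* ℝ) : 0 < y τ := by
  obtain ⟨t, ht, rfl⟩ := hy
  have : Nonempty (Fin r) := ⟨⟨0, hr⟩⟩
  simp only [Finset.sum_apply, Pi.smul_apply, smul_eq_mul, embed]
  exact Finset.sum_pos (fun i _ => mul_pos (ht i) (hv i τ)) Finset.univ_nonempty

lemma realVec_posVec_shift (e : T → F →+* ℝ) {M : ℕ} {r : ℕ} {v : Fin r → 𝓞 F}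
    (hv : ∀ i (τ : F →+* ℝ), 0 < τ (v i : F)) {x : F} (hx : ∀ τ : F →+* ℝ, 0 < τ x)
    (n : Fin r → ℕ) (t : T) :
    realVec (posVec e x + comb (fun i => posVec e ((M : F) * (v i : F))) n) t =
      e t (shift M v x n) := by
  have h1 := congrFun (embed_shift M v x n) (e t)
  have h2 : ∀ i, ((e t ((M : F) * (v i : F))).toNNReal : ℝ) = e t ((M : F) * (v i : F)) := by
    intro i
    refine Real.coe_toNNReal _ ?_
    rw [map_mul, map_natCast]
    exact mul_nonneg (by positivity) (hv i _).le
  simp only [embed, Pi.add_apply, Finset.sum_apply, Pi.smul_apply, smul_eq_mul] at h1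
  rw [h1, realVec_add, Pi.add_apply, realVec_apply, realVec_apply, comb, posVec,
    Real.coe_toNNReal _ (hx _).le, Finset.sum_apply, NNReal.coe_sum]
  congr 1
  refine Finset.sum_congr rfl fun i _ => ?_
  rw [Pi.smul_apply, nsmul_eq_mul, NNReal.coe_mul, NNReal.coe_natCast]
  simp only [posVec, h2]

variable [Fintype T]

lemma powFun_eq_prod_cpow (s : ℂ) {u : T → ℝ} (hu : ∀ t, 0 ≤ u t) :
    powFun (fun _ => s) u = ((∏ t, u t : ℝ) : ℂ) ^ (-s) := by
  classical
  rw [powFun]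
  generalize (Finset.univ : Finset T) = A
  induction A using Finset.induction_on with
  | empty => simp
  | insert a A ha ih =>
    rw [Finset.prod_insert ha, Finset.prod_insert ha, ih, Complex.ofReal_mul,
      Complex.mul_cpow_ofReal_nonneg (hu a) (Finset.prod_nonneg fun t _ => hu t)]

lemma powFun_posVec_shift (e : T → F →+* ℝ) {M : ℕ} (hM : 0 < M) {r : ℕ} (hr : 0 < r)
    {v : Fin r → 𝓞 F} (hv : ∀ i (τ : F →+* ℝ), 0 < τ (v i : F)) {x : F} (hx : embed x ∈ cone v)
    (n : Fin r → ℕ) (s : ℂ) :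
    powFun (fun _ => s) (realVec (posVec e x + comb (fun i => posVec e ((M : F) * (v i : F))) n)) =
      ((∏ t, e t (shift M v x n) : ℝ) : ℂ) ^ (-s) := by
  have h1 : realVec (posVec e x + comb (fun i => posVec e ((M : F) * (v i : F))) n) =
      fun t => e t (shift M v x n) :=
    funext fun t => realVec_posVec_shift e hv (fun τ => cone_pos hr hv hx τ) n t
  rw [h1, powFun_eq_prod_cpow]
  exact fun t => (cone_pos hr hv (shift_mem_cone hM hx n) (e t)).le

variable [NumberField F] [NumberField.IsTotallyReal F] [Nonempty T]
  {D : Set ((F →+* ℝ) → ℝ)} {k : ℕ} {r : Fin k → ℕ} {v : ∀ j, Fin (r j) → 𝓞 F} {M : ℕ} {S : Set F}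

/-- The zeta function of a periodic subset of a Shintani set has a meromorphic continuation which
is analytic at `0`. -/
theorem hasContinuation_of_periodic (e : T → F →+* ℝ) (hdec : IsConeDecomposition D r v)
    (hpos : ∀ j i (τ : F →+* ℝ), 0 < τ (v j i : F)) (hM : 0 < M)
    (hper : ∀ (j : Fin k) (x : F) (n : Fin (r j) → ℕ), embed x ∈ cone (v j) →
      (x ∈ S ↔ shift M (v j) x n ∈ S))
    (hfin : ∀ j, (boxReps S M (v j)).Finite) :
    HasContinuation {z | z ∈ S ∧ embed z ∈ D} fun z => ∏ t, e t z := by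
  have hM' : (0 : ℝ) < M := by exact_mod_cast hM
  have key : ∀ (j : Fin k) (x : F), ∃ (Z : ℂ → ℂ) (σ : ℝ), MeromorphicOn Z Set.univ ∧
      AnalyticAt ℂ Z 0 ∧ (x ∈ boxReps S M (v j) → ∀ s : ℂ, σ < s.re →
        HasSum (fun n => ((∏ t, e t (shift M (v j) x n) : ℝ) : ℂ) ^ (-s)) (Z s)) := by
    intro j x
    by_cases hx : x ∈ boxReps S M (v j)
    · have hxc := boxReps_subset_cone hM hx
      obtain ⟨Z, h1, h2, σ, h3⟩ := exists_continuation_untwisted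
        (x := posVec e x) (v := fun i => posVec e ((M : F) * (v j i : F)))
        (fun t => Real.toNNReal_pos.2 (cone_pos (hdec.1 j) (hpos j) hxc (e t)))
        (fun i t => Real.toNNReal_pos.2 (by
          rw [map_mul, map_natCast]
          exact mul_pos hM' (hpos j i (e t))))
      refine ⟨Z, σ, h1, h2, fun _ s hs => ?_⟩
      simpa only [powFun_posVec_shift e hM (hdec.1 j) (hpos j) hxc] using h3 s hs
    · exact ⟨fun _ => 0, 0, fun _ _ => MeromorphicAt.const 0 _, analyticAt_const,
        fun h => absurd h hx⟩
  choose Z σ hZm hZa hZs using key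
  refine ⟨fun s => ∑ j, ∑ x ∈ (hfin j).toFinset, Z j x s,
    ⟨∑ j, ∑ x ∈ (hfin j).toFinset, |σ j x|, fun s hs => ?_⟩, fun s _ => ?_, ?_⟩
  · refine hasSum_coneDecomposition hdec hM hper hfin
      (fun z => ((∏ t, e t z : ℝ) : ℂ) ^ (-s)) (fun j x => Z j x s) fun j x hx => ?_
    refine hZs j x hx s (lt_of_le_of_lt ?_ hs)
    calc σ j x ≤ |σ j x| := le_abs_self _
      _ ≤ ∑ x ∈ (hfin j).toFinset, |σ j x| :=
        Finset.single_le_sum (f := fun x => |σ j x|) (fun _ _ => abs_nonneg _)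
          ((hfin j).mem_toFinset.2 hx)
      _ ≤ _ := Finset.single_le_sum (f := fun j => ∑ x ∈ (hfin j).toFinset, |σ j x|)
        (fun _ _ => by positivity) (Finset.mem_univ j)
  · exact MeromorphicAt.fun_sum fun j _ =>
      MeromorphicAt.fun_sum fun x _ => hZm j x s (Set.mem_univ s)
  · exact Finset.analyticAt_fun_sum _ fun j _ => Finset.analyticAt_fun_sum _ fun x _ => hZa j x

/-- The zeta function of a periodic set with coefficients which are multiplied by `ξᵢ ≠ 1` under
translation by the `i`-th generator continues analytically beyond `0`, and its value at `0` does
not depend on the embeddings used. -/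
theorem exists_continuation_twisted_periodic (e : T → F →+* ℝ) (hdec : IsConeDecomposition D r v)
    (hpos : ∀ j i (τ : F →+* ℝ), 0 < τ (v j i : F)) (hM : 0 < M)
    (hper : ∀ (j : Fin k) (x : F) (n : Fin (r j) → ℕ), embed x ∈ cone (v j) →
      (x ∈ S ↔ shift M (v j) x n ∈ S))
    (hfin : ∀ j, (boxReps S M (v j)).Finite) (c : F → ℂ) (ξ : ∀ j, Fin (r j) → ℂ)
    (hξ : ∀ j i, ‖ξ j i‖ ≤ 1) (hξ1 : ∀ j i, ξ j i ≠ 1)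
    (hc : ∀ j, ∀ x ∈ boxReps S M (v j), ∀ n, c (shift M (v j) x n) = c x * ∏ i, ξ j i ^ n i) :
    ∃ Z : ℂ → ℂ, (∀ s : ℂ, -1 < Fintype.card T * s.re → AnalyticAt ℂ Z s) ∧
      Z 0 = ∑ j, ∑ x ∈ (hfin j).toFinset, c x * ∏ i, (1 - ξ j i)⁻¹ ∧
      ∃ σ : ℝ, ∀ s : ℂ, σ < s.re →
        HasSum ((fun z => c z * ((∏ t, e t z : ℝ) : ℂ) ^ (-s)) ∘
          (Subtype.val : {z | z ∈ S ∧ embed z ∈ D} → F)) (Z s) := by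
  have hM' : (0 : ℝ) < M := by exact_mod_cast hM
  have key : ∀ (j : Fin k) (x : F), ∃ (Z : ℂ → ℂ) (σ : ℝ),
      (∀ s : ℂ, -1 < Fintype.card T * s.re → AnalyticAt ℂ Z s) ∧
      (x ∈ boxReps S M (v j) → Z 0 = c x * ∏ i, (1 - ξ j i)⁻¹) ∧
      (x ∈ boxReps S M (v j) → ∀ s : ℂ, σ < s.re →
        HasSum (fun n => c (shift M (v j) x n) *
          ((∏ t, e t (shift M (v j) x n) : ℝ) : ℂ) ^ (-s)) (Z s)) := by
    intro j x
    by_cases hx : x ∈ boxReps S M (v j)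
    · have hxc := boxReps_subset_cone hM hx
      obtain ⟨Z, h1, h2, σ, h3⟩ := exists_continuation_twisted
        (x := posVec e x) (v := fun i => posVec e ((M : F) * (v j i : F)))
        (fun t => Real.toNNReal_pos.2 (cone_pos (hdec.1 j) (hpos j) hxc (e t)))
        (fun i t => Real.toNNReal_pos.2 (by
          rw [map_mul, map_natCast]
          exact mul_pos hM' (hpos j i (e t)))) (ξ j) (hξ j) (hξ1 j)
      refine ⟨fun s => c x * Z s, σ, fun s hs => analyticAt_const.mul (h1 s hs),
        fun _ => by simp only [h2], fun _ s hs => ?_⟩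
      have h4 := (h3 s hs).mul_left (c x)
      simpa only [powFun_posVec_shift e hM (hdec.1 j) (hpos j) hxc, hc j x hx, mul_assoc] using h4
    · exact ⟨fun _ => 0, 0, fun _ _ => analyticAt_const, fun h => absurd h hx,
        fun h => absurd h hx⟩
  choose Z σ hZa hZ0 hZs using key
  refine ⟨fun s => ∑ j, ∑ x ∈ (hfin j).toFinset, Z j x s, fun s hs => ?_, ?_,
    ∑ j, ∑ x ∈ (hfin j).toFinset, |σ j x|, fun s hs => ?_⟩
  · exact Finset.analyticAt_fun_sum _ fun j _ =>
      Finset.analyticAt_fun_sum _ fun x _ => hZa j x s hs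
  · exact Finset.sum_congr rfl fun j _ => Finset.sum_congr rfl fun x hx =>
      hZ0 j x ((hfin j).mem_toFinset.1 hx)
  · refine hasSum_coneDecomposition hdec hM hper hfin
      (fun z => c z * ((∏ t, e t z : ℝ) : ℂ) ^ (-s)) (fun j x => Z j x s) fun j x hx => ?_
    refine hZs j x hx s (lt_of_le_of_lt ?_ hs)
    calc σ j x ≤ |σ j x| := le_abs_self _
      _ ≤ ∑ x ∈ (hfin j).toFinset, |σ j x| :=
        Finset.single_le_sum (f := fun x => |σ j x|) (fun _ _ => abs_nonneg _)
          ((hfin j).mem_toFinset.2 hx)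
      _ ≤ _ := Finset.single_le_sum (f := fun j => ∑ x ∈ (hfin j).toFinset, |σ j x|)
        (fun _ _ => by positivity) (Finset.mem_univ j)

end PeriodicZeta

open IsDedekindDomain

/-! ### Periods of the index sets -/

section Periods

variable {F : Type*} [Field F]

lemma rayUnits_add_mem {𝔣 : Ideal (𝓞 F)} {z : F} (hz : z ∈ rayUnits 𝔣) {c : 𝓞 F} (hc : c ∈ 𝔣)
    (h0 : z + c ≠ 0) : z + c ∈ rayUnits 𝔣 := by
  obtain ⟨-, a, b, hb, hcop, hab, rfl⟩ := hz
  have hb' : (b : F) ≠ 0 := by exact_mod_cast hb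
  refine ⟨h0, a + b * c, b, hb, hcop, ?_, ?_⟩
  · have : a + b * c - b = (a - b) + b * c := by ring
    rw [this]
    exact 𝔣.add_mem hab (𝔣.mul_mem_left _ hc)
  · push_cast
    field_simp

lemma natCast_mul_mem {I : FractionalIdeal (𝓞 F)⁰ F} {M : ℕ} (hM : (M : F) ∈ I) (a : 𝓞 F) :
    (M : F) * (a : F) ∈ I := by
  have := Submodule.smul_mem (I : Submodule (𝓞 F) F) a hM
  rwa [Algebra.smul_def, mul_comm] at this

variable [NumberField F]

/-- M is the prime-to-q part of the norm of I: a power of q is invertible modulo I, so it can be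
cancelled. -/
lemma exists_natCast_mem_of_isCoprime {q : ℕ} (hq : q.Prime) {I : Ideal (𝓞 F)} (hI : I ≠ ⊥)
    (hcop : IsCoprime (Ideal.span {(q : 𝓞 F)}) I) :
    ∃ M : ℕ, 0 < M ∧ ¬ q ∣ M ∧ (M : 𝓞 F) ∈ I := by
  have h0 : Ideal.absNorm I ≠ 0 := Ideal.absNorm_ne_zero_iff_mem_nonZeroDivisors.2
    (mem_nonZeroDivisors_of_ne_zero hI)
  obtain ⟨a, M, hM, e⟩ := Nat.exists_eq_pow_mul_and_not_dvd h0 q hq.ne_one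
  refine ⟨M, Nat.pos_of_ne_zero fun h => hM (h ▸ dvd_zero q), hM, ?_⟩
  have h1 : ((q : 𝓞 F) ^ a * M) ∈ I := by
    have := Ideal.absNorm_mem I
    rw [e] at this
    exact_mod_cast this
  have h2 : IsCoprime (Ideal.span {(q : 𝓞 F) ^ a}) I := by
    rw [← Ideal.span_singleton_pow]
    exact hcop.pow_left
  obtain ⟨x, hx, y, hy, hxy⟩ := Ideal.isCoprime_iff_exists.1 h2
  obtain ⟨z, rfl⟩ := Ideal.mem_span_singleton'.1 hx
  have h3 : (M : 𝓞 F) = z * ((q : 𝓞 F) ^ a * M) + y * M := by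
    linear_combination (-(M : 𝓞 F)) * hxy
  rw [h3]
  exact I.add_mem (I.mul_mem_left _ h1) (I.mul_mem_right _ hy)

lemma exists_natCast_mem_fractionalIdeal {J : FractionalIdeal (𝓞 F)⁰ F} (hJ : J ≠ 0) :
    ∃ M : ℕ, 0 < M ∧ (M : F) ∈ J := by
  have hnum : J.num ≠ ⊥ := fun h => hJ (FractionalIdeal.num_eq_zero_iff.1 h)
  refine ⟨Ideal.absNorm J.num, Nat.pos_of_ne_zero
    (Ideal.absNorm_ne_zero_iff_mem_nonZeroDivisors.2 (mem_nonZeroDivisors_of_ne_zero hnum)), ?_⟩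
  have h1 : (Ideal.absNorm J.num : F) ∈ Submodule.map (Algebra.linearMap (𝓞 F) F) J.num :=
    ⟨_, Ideal.absNorm_mem J.num, by simp⟩
  rw [← J.den_mul_self_eq_num] at h1
  obtain ⟨y, hy, e⟩ := h1
  rw [← e]
  exact Submodule.smul_mem (J : Submodule (𝓞 F) F) _ hy

lemma fractionalIdeal_le_one_of_count_nonneg {J : FractionalIdeal (𝓞 F)⁰ F} (hJ : J ≠ 0)
    (h : ∀ 𝔮, 0 ≤ FractionalIdeal.count F 𝔮 J) : J ≤ 1 := by
  rw [← FractionalIdeal.finprod_heightOneSpectrum_factorization' F hJ]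
  refine finprod_induction (· ≤ 1) le_rfl (fun x y hx hy => mul_le_one' hx hy) fun 𝔮 => ?_
  obtain ⟨n, hn⟩ := Int.eq_ofNat_of_zero_le (h 𝔮)
  rw [hn, zpow_natCast, ← FractionalIdeal.coeIdeal_pow]
  exact FractionalIdeal.coeIdeal_le_one

/-- A fractional ideal prime to the rational prime `q` contains a positive integer prime
to `q`. -/
lemma exists_natCast_mem_of_count_eq_zero {q : ℕ} (hq : q.Prime) {J : FractionalIdeal (𝓞 F)⁰ F}
    (hJ : J ≠ 0) (h : ∀ 𝔮 : HeightOneSpectrum (𝓞 F), 𝔮.asIdeal ∣ Ideal.span {(q : 𝓞 F)} →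
      FractionalIdeal.count F 𝔮 J = 0) :
    ∃ M : ℕ, 0 < M ∧ ¬ q ∣ M ∧ (M : F) ∈ J := by
  classical
  obtain ⟨M₀, hM₀, hM₀J⟩ := exists_natCast_mem_fractionalIdeal hJ
  obtain ⟨a, M, hM, e⟩ := Nat.exists_eq_pow_mul_and_not_dvd hM₀.ne' q hq.ne_one
  have hM0 : M ≠ 0 := fun h => hM (h ▸ dvd_zero q)
  refine ⟨M, Nat.pos_of_ne_zero hM0, hM, ?_⟩
  have hspan : ∀ {n : ℕ}, n ≠ 0 →
      ((Ideal.span {(n : 𝓞 F)} : Ideal (𝓞 F)) : FractionalIdeal (𝓞 F)⁰ F) ≠ 0 := by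
    intro n hn
    rw [FractionalIdeal.coeIdeal_ne_zero, Ne, Ideal.span_singleton_eq_bot]
    exact_mod_cast hn
  have hmem : ∀ {n : ℕ} {K : FractionalIdeal (𝓞 F)⁰ F},
      ((Ideal.span {(n : 𝓞 F)} : Ideal (𝓞 F)) : FractionalIdeal (𝓞 F)⁰ F) ≤ K ↔ (n : F) ∈ K := by
    intro n K
    rw [FractionalIdeal.coeIdeal_span_singleton, FractionalIdeal.spanSingleton_le_iff_mem,
      map_natCast]
  rw [← hmem]
  -- Checked prime by prime: above q the ideal J has exponent 0, and elsewhere M has the same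
  -- exponent as M₀ ∈ J.
  have h1 : ((Ideal.span {(M : 𝓞 F)} : Ideal (𝓞 F)) : FractionalIdeal (𝓞 F)⁰ F) * J⁻¹ ≤ 1 := by
    refine fractionalIdeal_le_one_of_count_nonneg (mul_ne_zero (hspan hM0) (inv_ne_zero hJ))
      fun 𝔮 => ?_
    rw [FractionalIdeal.count_mul F 𝔮 (hspan hM0) (inv_ne_zero hJ), FractionalIdeal.count_inv]
    by_cases h𝔮 : 𝔮.asIdeal ∣ Ideal.span {(q : 𝓞 F)}
    · rw [h 𝔮 h𝔮, neg_zero, add_zero]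
      exact FractionalIdeal.count_coe_nonneg F 𝔮 _
    · have h2 := FractionalIdeal.count_mono F 𝔮 (hspan hM₀.ne') (hmem.2 hM₀J)
      have h3 : Ideal.span {(M₀ : 𝓞 F)} =
          Ideal.span {(q : 𝓞 F)} ^ a * Ideal.span {(M : 𝓞 F)} := by
        rw [Ideal.span_singleton_pow, Ideal.span_singleton_mul_span_singleton, e]
        push_cast
        rfl
      have hq0 : Ideal.span {(q : 𝓞 F)} ≠ 0 := by
        exact FractionalIdeal.coeIdeal_ne_zero.1 (hspan hq.ne_zero)
      have h4 : FractionalIdeal.count F 𝔮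
          ((Ideal.span {(q : 𝓞 F)} : Ideal (𝓞 F)) : FractionalIdeal (𝓞 F)⁰ F) = 0 := by
        rw [FractionalIdeal.count_coe F 𝔮 hq0]
        by_contra h5
        exact h𝔮 ((Associates.count_ne_zero_iff_dvd hq0 𝔮.irreducible).1 (by exact_mod_cast h5))
      rw [h3, FractionalIdeal.coeIdeal_mul, FractionalIdeal.coeIdeal_pow,
        FractionalIdeal.count_mul F 𝔮 (pow_ne_zero _ (hspan hq.ne_zero)) (hspan hM0),
        FractionalIdeal.count_pow, h4, mul_zero, zero_add] at h2
      linarith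
  have h6 := mul_le_mul_left h1 J
  rwa [mul_assoc, inv_mul_cancel₀ hJ, mul_one, one_mul] at h6

/-- A compact open subset of `F_𝔭` is invariant under translation by a power of any element
of `𝔭`. -/
lemma exists_pow_translation_invariant {𝔭 : HeightOneSpectrum (𝓞 F)}
    {𝓤 : Set (𝔭.adicCompletion F)} (ho : IsOpen 𝓤) (hc : IsCompact 𝓤) {m : 𝓞 F}
    (hm : m ∈ 𝔭.asIdeal) :
    ∃ k : ℕ, ∀ (z : F) (a : 𝓞 F), algebraMap F (𝔭.adicCompletion F) z ∈ 𝓤 →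
      algebraMap F (𝔭.adicCompletion F) (z + ((m ^ k * a : 𝓞 F) : F)) ∈ 𝓤 := by
  -- A compact open set absorbs a neighbourhood V of 0. High powers of m lie in a valuation ball
  -- inside V, and integral multiples do not leave that ball.
  obtain ⟨V, hV, hUV⟩ := compact_open_separated_add_right hc ho subset_rfl
  obtain ⟨γ, hγ⟩ := Valued.mem_nhds_zero.1 hV
  have hval : ∀ x : F, Valued.v (algebraMap F (𝔭.adicCompletion F) x) = 𝔭.valuation F x := by
    intro x
    exact HeightOneSpectrum.valuedAdicCompletion_eq_valuation' 𝔭 x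
  have hlt : Valued.v (algebraMap F (𝔭.adicCompletion F) (m : F)) < 1 := by
    rw [hval]
    exact (𝔭.valuation_lt_one_iff_mem m).2 hm
  have ht := Valued.tendsto_zero_pow_of_v_lt_one hlt
  obtain ⟨k, hk⟩ := (ht.eventually (Valued.mem_nhds_zero.2 ⟨γ, subset_rfl⟩)).exists
  refine ⟨k, fun z a hz => ?_⟩
  rw [map_add]
  refine hUV (Set.add_mem_add hz (hγ ?_))
  refine lt_of_le_of_lt ?_ hk
  rw [Valuation.restrict_le_iff, NumberField.RingOfIntegers.coe_eq_algebraMap, map_mul, map_mul,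
    map_mul, map_pow, map_pow]
  refine mul_le_of_le_one_right' ?_
  rw [hval]
  exact 𝔭.valuation_le_one a

/-- The arithmetic part of the index set `F_𝔣^× ∩ I ∩ 𝓤`. -/
def arithSet (𝔣 : Ideal (𝓞 F)) (𝔭 : HeightOneSpectrum (𝓞 F)) (I : FractionalIdeal (𝓞 F)⁰ F)
    (𝓤 : Set (𝔭.adicCompletion F)) : Set F :=
  {z | z ∈ rayUnits 𝔣 ∧ z ∈ I ∧ algebraMap F (𝔭.adicCompletion F) z ∈ 𝓤}

lemma indexSet_eq (𝔣 : Ideal (𝓞 F)) (𝔭 : HeightOneSpectrum (𝓞 F)) (I : FractionalIdeal (𝓞 F)⁰ F)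
    (D : Set ((F →+* ℝ) → ℝ)) (𝓤 : Set (𝔭.adicCompletion F)) :
    indexSet 𝔣 𝔭 I D 𝓤 = {z | z ∈ arithSet 𝔣 𝔭 I 𝓤 ∧ embed z ∈ D} := by
  ext z
  simp only [indexSet, arithSet, Set.mem_ofPred_eq]
  tauto

/-- The arithmetic index set is periodic: if `m₁ ∈ I`, `m₂ ∈ 𝔣` and `m₃ ∈ 𝔭`, then the multiples
of `m₁ m₂ m₃ ^ k` are periods, for a suitable `k`. -/
lemma exists_period {𝔣 : Ideal (𝓞 F)} {𝔭 : HeightOneSpectrum (𝓞 F)}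
    {𝓤 : Set (𝔭.adicCompletion F)} (ho : IsOpen 𝓤) (hc : IsCompact 𝓤)
    {m₂ m₃ : ℕ} (h₂ : (m₂ : 𝓞 F) ∈ 𝔣) (h₃ : (m₃ : 𝓞 F) ∈ 𝔭.asIdeal) :
    ∃ k : ℕ, ∀ (I : FractionalIdeal (𝓞 F)⁰ F) (m₁ : ℕ), (m₁ : F) ∈ I →
      ∀ (z : F) (a : 𝓞 F), z ≠ 0 → z + ((m₁ * m₂ * m₃ ^ k : ℕ) : F) * (a : F) ≠ 0 →
        (z ∈ arithSet 𝔣 𝔭 I 𝓤 ↔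
          z + ((m₁ * m₂ * m₃ ^ k : ℕ) : F) * (a : F) ∈ arithSet 𝔣 𝔭 I 𝓤) := by
  obtain ⟨k, hk⟩ := exists_pow_translation_invariant ho hc h₃
  refine ⟨k, fun I m₁ h₁ => ?_⟩
  have key : ∀ (z : F) (a : 𝓞 F), z + ((m₁ * m₂ * m₃ ^ k : ℕ) : F) * (a : F) ≠ 0 →
      z ∈ arithSet 𝔣 𝔭 I 𝓤 →
        z + ((m₁ * m₂ * m₃ ^ k : ℕ) : F) * (a : F) ∈ arithSet 𝔣 𝔭 I 𝓤 := by
    rintro z a h0 ⟨hz1, hz2, hz3⟩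
    refine ⟨?_, ?_, ?_⟩
    · have e : ((m₁ * m₂ * m₃ ^ k : ℕ) : F) * (a : F) =
          ((m₁ * m₃ ^ k * a * m₂ : 𝓞 F) : F) := by
        push_cast
        ring
      rw [e] at h0 ⊢
      exact rayUnits_add_mem hz1 (𝔣.mul_mem_left _ h₂) h0
    · have e : ((m₁ * m₂ * m₃ ^ k : ℕ) : F) * (a : F) =
          (m₁ : F) * ((m₂ * m₃ ^ k * a : 𝓞 F) : F) := by
        push_cast
        ring
      rw [e]
      exact Submodule.add_mem (I : Submodule (𝓞 F) F) hz2 (natCast_mul_mem h₁ _)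
    · have e : ((m₁ * m₂ * m₃ ^ k : ℕ) : F) * (a : F) =
          ((m₃ ^ k * (m₁ * m₂ * a) : 𝓞 F) : F) := by
        push_cast
        ring
      rw [e]
      exact hk z _ hz3
  intro z a hz hza
  -- The converse is translation by -a.
  refine ⟨key z a hza, fun h => ?_⟩
  have h1 := key _ (-a) (by simpa using hz) h
  simpa using h1

end Periods

/-! ### Values at `s = 0` of smoothed zeta functions -/

section Smoothing

lemma IsContinuation.valueAtZero_eq {X : Type*} {R : Set X} {g : X → ℝ} {Z : ℂ → ℂ}
    (h : IsContinuation R g Z) : valueAtZero R g = Z 0 := by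
  have h' : HasContinuation R g := ⟨Z, h⟩
  rw [valueAtZero, dif_pos h']
  exact h'.choose_spec.value_unique h

/-- A meromorphic function analytic at `0` and a function analytic on a right half-plane around `0`
which agree far to the right have the same value at `0`. -/
lemma value_zero_eq_of_eq_on_halfPlane {f h : ℂ → ℂ} {m σ : ℝ} (hm : 0 ≤ m)
    (hf : MeromorphicOn f Set.univ) (hf0 : AnalyticAt ℂ f 0)
    (hh : ∀ s : ℂ, -1 < m * s.re → AnalyticAt ℂ h s) (heq : ∀ s : ℂ, σ < s.re → f s = h s) :
    f 0 = h 0 := by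
  set U : Set ℂ := {s | -1 < m * s.re} with hU
  have hUc : Convex ℝ U := by
    have h1 : U = (m • Complex.reLm : ℂ →ₗ[ℝ] ℝ) ⁻¹' Set.Ioi (-1) := by
      ext s
      simp [hU]
    rw [h1]
    exact (convex_Ioi (-1 : ℝ)).linear_preimage _
  have hmer : MeromorphicOn (f - h) U := fun s hs =>
    (hf s (Set.mem_univ s)).sub (hh s hs).meromorphicAt
  -- A point of U near which the two functions agree; the identity theorem on the convex set U
  -- carries the agreement to 0.
  set p : ℂ := ((max σ 0 + 1 : ℝ) : ℂ) with hp
  have hpre : p.re = max σ 0 + 1 := Complex.ofReal_re _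
  have hp1 : σ < p.re := by
    rw [hpre]
    linarith [le_max_left σ 0]
  have hpU : p ∈ U := by
    have : 0 ≤ p.re := by
      rw [hpre]
      linarith [le_max_right σ 0]
    have h2 : (0 : ℝ) ≤ m * p.re := mul_nonneg hm this
    change -1 < m * p.re
    linarith
  have h0U : (0 : ℂ) ∈ U := by simp [hU]
  have h1 : meromorphicOrderAt (f - h) p = ⊤ := by
    rw [meromorphicOrderAt_eq_top_iff]
    refine Filter.Eventually.filter_mono nhdsWithin_le_nhds ?_
    have ho : IsOpen {s : ℂ | σ < s.re} := isOpen_lt continuous_const Complex.continuous_re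
    filter_upwards [ho.mem_nhds hp1] with s hs
    rw [Pi.sub_apply, heq s hs, sub_self]
  have h2 : meromorphicOrderAt (f - h) 0 = ⊤ := by
    by_contra h3
    exact hmer.meromorphicOrderAt_ne_top_of_isPreconnected (x := 0) hUc.isPreconnected h0U hpU h3 h1
  have ha : AnalyticAt ℂ (f - h) 0 := hf0.sub (hh 0 h0U)
  rw [meromorphicOrderAt_eq_top_iff] at h2
  have h4 := ha.frequently_zero_iff_eventually_zero.mp h2.frequently
  exact sub_eq_zero.mp h4.self_of_nhds

lemma addChar_map_sum {G J : Type*} [AddCommGroup G] (ψ : AddChar G ℂ) (A : Finset J) (f : J → G) :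
    ψ (∑ i ∈ A, f i) = ∏ i ∈ A, ψ (f i) := by
  classical
  induction A using Finset.induction_on with
  | empty => simp
  | insert a A ha ih =>
    rw [Finset.sum_insert ha, Finset.prod_insert ha, AddChar.map_add_eq_mul, ih]

/-- In a group of prime order every nonzero g is a generator. This is where primality of Nη enters.
-/
lemma addChar_apply_ne_one {G : Type*} [AddCommGroup G] (hG : (Nat.card G).Prime)
    {ψ : AddChar G ℂ} (hψ : ψ ≠ 0) {g : G} (hg : g ≠ 0) : ψ g ≠ 1 := by
  intro h
  have : Fact (Nat.card G).Prime := ⟨hG⟩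
  refine hψ (DFunLike.ext _ _ fun y => ?_)
  obtain ⟨n, rfl⟩ := mem_multiples_of_prime_card (p := Nat.card G) rfl (g' := y) hg
  simp [AddChar.map_nsmul_eq_pow, h]

universe u

variable {F : Type u} [Field F] [NumberField F] [NumberField.IsTotallyReal F]
  {D : Set ((F →+* ℝ) → ℝ)} {k : ℕ} {r : Fin k → ℕ}
  {v : ∀ j, Fin (r j) → 𝓞 F} {M : ℕ} {S S' : Set F}

/-- If `S'` is the kernel of an additive map on `S` to a group of prime order which is nonzero on
all generators, then the smoothed value at `0` does not depend on the embeddings used. -/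
theorem exists_smoothed_value {G : Type*} [AddCommGroup G] [Finite G] (hG : (Nat.card G).Prime)
    (hdec : IsConeDecomposition D r v)
    (hpos : ∀ j i (τ : F →+* ℝ), 0 < τ (v j i : F)) (hM : 0 < M)
    (hper : ∀ (j : Fin k) (x : F) (n : Fin (r j) → ℕ), embed x ∈ cone (v j) →
      (x ∈ S ↔ shift M (v j) x n ∈ S))
    (hfin : ∀ j, (boxReps S M (v j)).Finite) (red : F → G) (g : ∀ j, Fin (r j) → G)
    (hg : ∀ j i, g j i ≠ 0)
    (hred : ∀ j, ∀ x ∈ boxReps S M (v j), ∀ n, red (shift M (v j) x n) = red x + ∑ i, n i • g j i)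
    (hS' : ∀ z, z ∈ S' ↔ z ∈ S ∧ red z = 0) :
    ∃ V : ℂ, ∀ (T : Type u) [Fintype T] [Nonempty T] (e : T → F →+* ℝ),
      HasContinuation {z | z ∈ S' ∧ embed z ∈ D} (fun z => ∏ t, e t z) →
      valueAtZero {z | z ∈ S ∧ embed z ∈ D} (fun z => ∏ t, e t z) -
        Nat.card G * valueAtZero {z | z ∈ S' ∧ embed z ∈ D} (fun z => ∏ t, e t z) = V := by
  classical
  have : Fintype G := Fintype.ofFinite G
  -- The value is written down before T is chosen: it involves only characters, classes and
  -- generators.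
  refine ⟨-∑ ψ ∈ (Finset.univ : Finset (AddChar G ℂ)).erase 0,
    ∑ j, ∑ x ∈ (hfin j).toFinset, ψ (red x) * ∏ i, (1 - ψ (g j i))⁻¹, fun T _ _ e hR' => ?_⟩
  have hR := hasContinuation_of_periodic e hdec hpos hM hper hfin
  obtain ⟨Z, hZ⟩ := hR
  obtain ⟨Z', hZ'⟩ := hR'
  rw [hZ.valueAtZero_eq, hZ'.valueAtZero_eq]
  have key : ∀ ψ : AddChar G ℂ, ∃ (W : ℂ → ℂ) (σ : ℝ), ψ ≠ 0 →
      (∀ s : ℂ, -1 < Fintype.card T * s.re → AnalyticAt ℂ W s) ∧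
      W 0 = ∑ j, ∑ x ∈ (hfin j).toFinset, ψ (red x) * ∏ i, (1 - ψ (g j i))⁻¹ ∧
      ∀ s : ℂ, σ < s.re → HasSum ((fun z => ψ (red z) * ((∏ t, e t z : ℝ) : ℂ) ^ (-s)) ∘
          (Subtype.val : {z | z ∈ S ∧ embed z ∈ D} → F)) (W s) := by
    intro ψ
    by_cases hψ : ψ = 0
    · exact ⟨fun _ => 0, 0, fun h => absurd hψ h⟩
    · obtain ⟨W, h1, h2, σ, h3⟩ := exists_continuation_twisted_periodic e hdec hpos hM hper hfin
        (fun z => ψ (red z)) (fun j i => ψ (g j i)) (fun j i => (AddChar.norm_apply ψ _).le)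
        (fun j i => addChar_apply_ne_one hG hψ (hg j i)) (fun j x hx n => by
          rw [hred j x hx n, AddChar.map_add_eq_mul, addChar_map_sum]
          simp only [AddChar.map_nsmul_eq_pow])
      exact ⟨W, σ, fun _ => ⟨h1, h2, h3⟩⟩
  choose W σ hW using key
  set E := (Finset.univ : Finset (AddChar G ℂ)).erase 0 with hE
  have hE' : ∀ ψ ∈ E, ψ ≠ 0 := fun ψ hψ => Finset.ne_of_mem_erase hψ
  obtain ⟨⟨σ₁, hσ₁⟩, hZm, hZa⟩ := hZ
  obtain ⟨⟨σ₂, hσ₂⟩, hZm', hZa'⟩ := hZ'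
  have hval := value_zero_eq_of_eq_on_halfPlane (f := fun s => Z s - Nat.card G * Z' s)
    (h := fun s => -∑ ψ ∈ E, W ψ s) (m := Fintype.card T)
    (σ := max (max σ₁ σ₂) (∑ ψ ∈ E, |σ ψ|)) (by positivity)
    (fun s hs => (hZm s hs).fun_sub ((MeromorphicAt.const _ s).fun_mul (hZm' s hs)))
    (hZa.fun_sub (analyticAt_const.fun_mul hZa'))
    (fun s hs => (Finset.analyticAt_fun_sum E fun ψ hψ => (hW ψ (hE' ψ hψ)).1 s hs).fun_neg) ?_
  · refine hval.trans (congrArg Neg.neg ?_)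
    exact Finset.sum_congr rfl fun ψ hψ => (hW ψ (hE' ψ hψ)).2.1
  · intro s hs
    have hs1 : σ₁ < s.re := lt_of_le_of_lt ((le_max_left _ _).trans (le_max_left _ _)) hs
    have hs2 : σ₂ < s.re := lt_of_le_of_lt ((le_max_right _ _).trans (le_max_left _ _)) hs
    have hs3 : ∀ ψ ∈ E, σ ψ < s.re := fun ψ hψ =>
      lt_of_le_of_lt ((le_abs_self _).trans ((Finset.single_le_sum (f := fun ψ => |σ ψ|)
        (fun _ _ => abs_nonneg _) hψ).trans (le_max_right _ _))) hs
    set φ : F → ℂ := fun z => ((∏ t, e t z : ℝ) : ℂ) ^ (-s) with hφ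
    have h1 : HasSum ({z | z ∈ S ∧ embed z ∈ D}.indicator φ) (Z s) :=
      hasSum_subtype_iff_indicator.1 (hσ₁ s hs1)
    have h2 : HasSum ({z | z ∈ S' ∧ embed z ∈ D}.indicator φ) (Z' s) :=
      hasSum_subtype_iff_indicator.1 (hσ₂ s hs2)
    have h3 : ∀ ψ ∈ E, HasSum ({z | z ∈ S ∧ embed z ∈ D}.indicator
        fun z => ψ (red z) * φ z) (W ψ s) := fun ψ hψ =>
      hasSum_subtype_iff_indicator.1 ((hW ψ (hE' ψ hψ)).2.2 s (hs3 ψ hψ))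
    have h4 := h1.sub (h2.mul_left (Nat.card G : ℂ))
    have h5 := (hasSum_sum h3).neg
    refine h4.unique ?_
    convert h5 using 2 with z
    -- Orthogonality of characters, with the trivial character moved to the right.
    have hsum : ∑ ψ ∈ E, ψ (red z) = (if red z = 0 then (Nat.card G : ℂ) else 0) - 1 := by
      have h6 := AddChar.sum_apply_eq_ite (red z)
      rw [← Finset.add_sum_erase _ _ (Finset.mem_univ (0 : AddChar G ℂ)),
        ← Nat.card_eq_fintype_card] at h6
      rw [hE, ← h6]
      simp
    by_cases hz : z ∈ S ∧ embed z ∈ D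
    · have hz1 : z ∈ {z | z ∈ S ∧ embed z ∈ D} := hz
      simp only [Set.indicator_of_mem hz1, ← Finset.sum_mul, hsum]
      by_cases hr0 : red z = 0
      · have hz2 : z ∈ {z | z ∈ S' ∧ embed z ∈ D} := ⟨(hS' z).2 ⟨hz.1, hr0⟩, hz.2⟩
        rw [Set.indicator_of_mem hz2, if_pos hr0]
        ring
      · have hz2 : z ∉ {z | z ∈ S' ∧ embed z ∈ D} := fun h => hr0 ((hS' z).1 h.1).2
        rw [Set.indicator_of_notMem hz2, if_neg hr0]
        ring
    · have hz1 : z ∉ {z | z ∈ S ∧ embed z ∈ D} := hz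
      have hz2 : z ∉ {z | z ∈ S' ∧ embed z ∈ D} := fun h => hz ⟨((hS' z).1 h.1).1, h.2⟩
      simp [Set.indicator_of_notMem hz1, Set.indicator_of_notMem hz2]

end Smoothing

/-! ### The norm as a product over the real embeddings. -/

section Norm

variable {F : Type*} [Field F] [NumberField F] [NumberField.IsTotallyReal F]

/-- In a totally real field, the norm is the product of the real embeddings. -/
lemma normReal_eq_prod (z : F) : normReal z = ∏ τ : F →+* ℝ, τ z := by
  have h1 := Algebra.norm_eq_prod_embeddings ℚ ℂ z
  have h2 : ∏ σ : F →ₐ[ℚ] ℂ, σ z = ∏ τ : F →+* ℝ, ((τ z : ℝ) : ℂ) := by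
    refine (Fintype.prod_bijective
      (fun τ : F →+* ℝ => RingHom.equivRatAlgHom F ℂ (Complex.ofRealHom.comp τ)) ⟨?_, ?_⟩ _ _
      fun τ => rfl).symm
    · intro τ σ h
      ext x
      have h3 := (RingHom.equivRatAlgHom F ℂ).injective h
      exact Complex.ofReal_injective (RingHom.congr_fun h3 x)
    · intro φ
      obtain ⟨τ, hτ⟩ := exists_real_embedding (φ : F →+* ℂ)
      exact ⟨τ, AlgHom.ext hτ⟩
  rw [h2, ← Complex.ofReal_prod, eq_ratCast] at h1
  rw [normReal]
  exact_mod_cast h1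

end Norm

/-! ### Reduction modulo `η` -/

section Reduction

variable {F : Type*} [Field F]

open Classical in
/-- The class of `N z` modulo `η`, for `z` with `N z` integral. -/
def redMod (η : Ideal (𝓞 F)) (N : ℕ) (z : F) : 𝓞 F ⧸ η :=
  if h : ∃ a : 𝓞 F, (a : F) = N * z then Ideal.Quotient.mk η h.choose else 0

lemma redMod_eq (η : Ideal (𝓞 F)) {N : ℕ} {z : F} {a : 𝓞 F} (h : (a : F) = N * z) :
    redMod η N z = Ideal.Quotient.mk η a := by
  have h' : ∃ a : 𝓞 F, (a : F) = N * z := ⟨a, h⟩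
  rw [redMod, dif_pos h']
  congr 1
  exact NumberField.RingOfIntegers.ext (h'.choose_spec.trans h.symm)

/-- Integrality of N x keeps every translate away from the default value 0, so the class moves
additively along an orbit and each character yields a twist ξ^n. -/
lemma redMod_shift {η : Ideal (𝓞 F)} {N : ℕ} {x : F} (hx : ∃ a : 𝓞 F, (a : F) = N * x) (M : ℕ)
    {r : ℕ} (v : Fin r → 𝓞 F) (n : Fin r → ℕ) :
    redMod η N (shift M v x n) =
      redMod η N x + ∑ i, n i • Ideal.Quotient.mk η ((N * M : ℕ) * v i) := by
  obtain ⟨a, ha⟩ := hx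
  have h1 : ((a + N * (M * ∑ i, (n i : 𝓞 F) * v i) : 𝓞 F) : F) = N * shift M v x n := by
    rw [shift, mul_add, ← ha]
    push_cast
    rfl
  rw [redMod_eq η h1, redMod_eq η ha, map_add]
  congr 1
  rw [Finset.mul_sum, Finset.mul_sum, map_sum]
  refine Finset.sum_congr rfl fun i _ => ?_
  rw [← map_nsmul, nsmul_eq_mul]
  congr 1
  push_cast
  ring

lemma exists_eq_natCast_mul [NumberField F] {𝔟 : FractionalIdeal (𝓞 F)⁰ F} (h𝔟 : 𝔟 ≠ 0) {N : ℕ}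
    (hN : (N : F) ∈ 𝔟) {z : F} (hz : z ∈ 𝔟⁻¹) : ∃ a : 𝓞 F, (a : F) = N * z := by
  have h1 := FractionalIdeal.mul_mem_mul hN hz
  rw [mul_inv_cancel₀ h𝔟] at h1
  obtain ⟨a, ha⟩ := (FractionalIdeal.mem_one_iff _).1 h1
  exact ⟨a, ha⟩

/-- For `z ∈ 𝔟⁻¹`, with `𝔟` prime to `η`, the reduction of `N z` vanishes exactly
for `z ∈ 𝔟⁻¹ η`. -/
lemma redMod_eq_zero_iff [NumberField F] {η : Ideal (𝓞 F)} [η.IsMaximal]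
    {𝔟 : FractionalIdeal (𝓞 F)⁰ F} (h𝔟 : 𝔟 ≠ 0) {N N' : ℕ} (hN : (N : F) ∈ 𝔟)
    (hN' : (N' : F) ∈ 𝔟⁻¹) (hη : ((N' * N : ℕ) : 𝓞 F) ∉ η) {z : F} (hz : z ∈ 𝔟⁻¹) :
    redMod η N z = 0 ↔ z ∈ 𝔟⁻¹ * (η : FractionalIdeal (𝓞 F)⁰ F) := by
  obtain ⟨a, ha⟩ := exists_eq_natCast_mul h𝔟 hN hz
  rw [redMod_eq η ha, Ideal.Quotient.eq_zero_iff_mem]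
  constructor
  · intro haη
    obtain ⟨y, w, hw, hyw⟩ := Ideal.IsMaximal.exists_inv ‹_› hη
    -- From 1 = y N'N + w with w ∈ η and a = N z; both summands lie in 𝔟⁻¹η.
    have h1 : z = (y : F) * ((N' : F) * (a : F)) + z * (w : F) := by
      have h2 := congrArg (fun t : 𝓞 F => (t : F)) hyw
      push_cast at h2
      rw [ha]
      linear_combination (-z) * h2
    rw [h1]
    refine Submodule.add_mem
      ((𝔟⁻¹ * (η : FractionalIdeal (𝓞 F)⁰ F) : FractionalIdeal (𝓞 F)⁰ F) : Submodule (𝓞 F) F) ?_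
      (FractionalIdeal.mul_mem_mul hz (FractionalIdeal.mem_coeIdeal_of_mem _ hw))
    have h3 := Submodule.smul_mem
      ((𝔟⁻¹ * (η : FractionalIdeal (𝓞 F)⁰ F) : FractionalIdeal (𝓞 F)⁰ F) : Submodule (𝓞 F) F) y
      (FractionalIdeal.mul_mem_mul hN' (FractionalIdeal.mem_coeIdeal_of_mem (𝓞 F)⁰ haη))
    rwa [Algebra.smul_def] at h3
  · intro hzη
    have h1 := FractionalIdeal.mul_mem_mul hN hzη
    rw [← mul_assoc, mul_inv_cancel₀ h𝔟, one_mul, ← ha] at h1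
    obtain ⟨a', ha', e⟩ := (FractionalIdeal.mem_coeIdeal _).1 h1
    have : a' = a := NumberField.RingOfIntegers.ext e
    rwa [← this]

end Reduction

lemma isContinuation_empty {X : Type*} (g : X → ℝ) : IsContinuation ∅ g fun _ => 0 :=
  ⟨⟨0, fun _ _ => hasSum_empty⟩, fun s _ => MeromorphicAt.const 0 s, analyticAt_const⟩

/-- By Bézout, since η contains Nη and would otherwise contain 1. -/
lemma natCast_notMem_of_not_dvd {F : Type*} [Field F] [NumberField F]
    (η : HeightOneSpectrum (𝓞 F)) (hq : (Ideal.absNorm η.asIdeal).Prime) {n : ℕ}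
    (hn : ¬ Ideal.absNorm η.asIdeal ∣ n) : (n : 𝓞 F) ∉ η.asIdeal := by
  intro h
  have hcop : IsCoprime (Ideal.absNorm η.asIdeal : ℤ) (n : ℤ) :=
    Nat.isCoprime_iff_coprime.2 ((Nat.Prime.coprime_iff_not_dvd hq).2 hn)
  obtain ⟨a, b, hab⟩ := hcop
  refine η.isPrime.ne_top ((Ideal.eq_top_iff_one _).2 ?_)
  have h1 := congrArg (fun t : ℤ => (t : 𝓞 F)) hab
  push_cast at h1
  rw [← h1]
  exact Ideal.add_mem _ (Ideal.mul_mem_left _ _ (Ideal.absNorm_mem _)) (Ideal.mul_mem_left _ _ h)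

end ShintaniZeta

end

/-! ### Comparison of the norm and the single embedding. -/

open ShintaniZeta IsDedekindDomain in
theorem lemma5p4 {F : Type*} [Field F] [NumberField F] [NumberField.IsTotallyReal F]
    (ι : F →+* ℝ) (𝔣 : Ideal (𝓞 F)) (h𝔣 : 𝔣 ≠ ⊥)
    (𝔭 : HeightOneSpectrum (𝓞 F)) (h𝔭𝔣 : ¬ 𝔭.asIdeal ∣ 𝔣)
    (η : HeightOneSpectrum (𝓞 F))
    (hη : IsCoprime (Ideal.span {(Ideal.absNorm η.asIdeal : 𝓞 F)}) (𝔣 * 𝔭.asIdeal))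
    (𝔟 : FractionalIdeal (𝓞 F)⁰ F) (h𝔟 : 𝔟 ≠ 0)
    (h𝔟cop : ∀ 𝔮 : HeightOneSpectrum (𝓞 F),
      𝔮.asIdeal ∣ 𝔣 * 𝔭.asIdeal * Ideal.span {(Ideal.absNorm η.asIdeal : 𝓞 F)} →
        FractionalIdeal.count F 𝔮 𝔟 = 0)
    (D : Set ((F →+* ℝ) → ℝ)) (hD : IsShintaniSet D) (hgood : IsGoodFor η D)
    (𝓤 : Set (𝔭.adicCompletion F)) (h𝓤open : IsOpen 𝓤) (h𝓤compact : IsCompact 𝓤)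
    (h𝓤int : 𝓤 ⊆ (𝔭.adicCompletionIntegers F : Set (𝔭.adicCompletion F))) :
    -- all zeta values involved are values of actual meromorphic continuations
    (HasContinuation (indexSet 𝔣 𝔭 𝔟⁻¹ D 𝓤) normReal ∧
      HasContinuation
        (indexSet 𝔣 𝔭 (𝔟 * (η.asIdeal : FractionalIdeal (𝓞 F)⁰ F)⁻¹)⁻¹ D 𝓤) normReal ∧
      HasContinuation (indexSet 𝔣 𝔭 𝔟⁻¹ D 𝓤) ι ∧
      HasContinuation
        (indexSet 𝔣 𝔭 (𝔟⁻¹ * (η.asIdeal : FractionalIdeal (𝓞 F)⁰ F)) D 𝓤) ι) ∧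
    nuEta 𝔣 𝔭 η 𝔟 D 𝓤 =
      zetaAtZero ι (indexSet 𝔣 𝔭 𝔟⁻¹ D 𝓤) -
        (Ideal.absNorm η.asIdeal : ℂ) *
          zetaAtZero ι (indexSet 𝔣 𝔭 (𝔟⁻¹ * (η.asIdeal : FractionalIdeal (𝓞 F)⁰ F)) D 𝓤) := by
  have hne : Nonempty (F →+* ℝ) := ⟨ι⟩
  obtain ⟨k, r, v, hdec, hv⟩ := hgood
  have hinv : (𝔟 * (η.asIdeal : FractionalIdeal (𝓞 F)⁰ F)⁻¹)⁻¹ =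
      𝔟⁻¹ * (η.asIdeal : FractionalIdeal (𝓞 F)⁰ F) := by
    rw [mul_inv, inv_inv]
  rw [nuEta, nu, nu, zetaNormAtZero, zetaNormAtZero, zetaAtZero, zetaAtZero, hinv]
  set I' : FractionalIdeal (𝓞 F)⁰ F := 𝔟⁻¹ * (η.asIdeal : FractionalIdeal (𝓞 F)⁰ F) with hI'
  rw [indexSet_eq, indexSet_eq]
  have hnorm : (normReal : F → ℝ) = fun z => ∏ τ : F →+* ℝ, (id τ : F →+* ℝ) z :=
    funext normReal_eq_prod
  -- The single embedding is a product over a one-point family T.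
  have hι : (ι : F → ℝ) = fun z => ∏ _t : PUnit, ι z := by
    funext z
    simp
  have hpos : ∀ j i (τ : F →+* ℝ), 0 < τ (v j i : F) := by
    intro j
    refine totallyPositive_of_cone_pos (fun i h => (hdec.2.1 j).ne_zero i (by simp [h])) ?_
    intro y hy τ
    obtain ⟨k₀, r₀, v₀, hdec₀, hpos₀⟩ := hD
    have hyD : y ∈ D := by
      rw [hdec.2.2.2]
      exact Set.mem_iUnion.2 ⟨j, hy⟩
    rw [hdec₀.2.2.2] at hyD
    obtain ⟨j₀, hj₀⟩ := Set.mem_iUnion.1 hyD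
    exact cone_pos (hdec₀.1 j₀) (hpos₀ j₀) hj₀ τ
  have hne0 : ∀ {j : Fin k} {x : F}, embed x ∈ cone (v j) → x ≠ 0 := by
    rintro j x hx rfl
    have := cone_pos (hdec.1 j) (hpos j) hx ι
    simp [embed] at this
  have hperiod : ∀ {S : Set F} {M : ℕ}, 0 < M → (∀ (z : F) (a : 𝓞 F), z ≠ 0 →
      z + (M : F) * (a : F) ≠ 0 → (z ∈ S ↔ z + (M : F) * (a : F) ∈ S)) →
      ∀ (j : Fin k) (x : F) (n : Fin (r j) → ℕ), embed x ∈ cone (v j) →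
        (x ∈ S ↔ shift M (v j) x n ∈ S) := fun hM h j x n hx =>
    h x _ (hne0 hx) (hne0 (shift_mem_cone hM hx n))
  -- Without cones D is empty, and goodness then gives no primality of Nη.
  rcases Nat.eq_zero_or_pos k with hk | hk
  · have hempty : ∀ S : Set F, {z | z ∈ S ∧ embed z ∈ D} = ∅ := by
      subst hk
      intro S
      ext z
      simp [hdec.2.2.2]
    have h0 := fun g : F → ℝ => isContinuation_empty g
    simp only [hempty, (h0 _).valueAtZero_eq, mul_zero, and_true]
    exact ⟨⟨_, h0 _⟩, ⟨_, h0 _⟩, ⟨_, h0 _⟩, ⟨_, h0 _⟩⟩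
  have hq : (Ideal.absNorm η.asIdeal).Prime := (hv ⟨0, hk⟩).2
  set q := Ideal.absNorm η.asIdeal with hqdef
  -- All these integers are prime to q. N clears the denominators of 𝔟⁻¹, and m₁, m₂, m₃ provide a
  -- period for the conditions at 𝔟⁻¹, 𝔣 and 𝓤.
  obtain ⟨m₂, hm₂, hqm₂, hm₂𝔣⟩ := exists_natCast_mem_of_isCoprime hq h𝔣 hη.of_mul_right_left
  obtain ⟨m₃, hm₃, hqm₃, hm₃𝔭⟩ := exists_natCast_mem_of_isCoprime hq 𝔭.ne_bot hη.of_mul_right_right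
  obtain ⟨N, hN, hqN, hN𝔟⟩ := exists_natCast_mem_of_count_eq_zero hq h𝔟 fun 𝔮 h𝔮 =>
    h𝔟cop 𝔮 (h𝔮.mul_left _)
  obtain ⟨m₁, hm₁, hqm₁, hm₁𝔟⟩ := exists_natCast_mem_of_count_eq_zero hq (inv_ne_zero h𝔟)
    fun 𝔮 h𝔮 => by rw [FractionalIdeal.count_inv, h𝔟cop 𝔮 (h𝔮.mul_left _), neg_zero]
  obtain ⟨l, hl⟩ := exists_period (𝔣 := 𝔣) h𝓤open h𝓤compact hm₂𝔣 hm₃𝔭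
  have hM : 0 < m₁ * m₂ * m₃ ^ l := by positivity
  have hqM : ¬ q ∣ m₁ * m₂ * m₃ ^ l := by
    rw [hq.dvd_mul, hq.dvd_mul]
    rintro ((h | h) | h)
    exacts [hqm₁ h, hqm₂ h, hqm₃ (hq.dvd_of_dvd_pow h)]
  -- A period for 𝔟⁻¹η needs the extra factor q ∈ η. It serves only to continue that zeta function,
  -- where divisibility by q is harmless.
  have hM' : 0 < q * m₁ * m₂ * m₃ ^ l := by
    have := hq.pos
    positivity
  have hm₁' : ((q * m₁ : ℕ) : F) ∈ I' := by
    have h1 := FractionalIdeal.mul_mem_mul hm₁𝔟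
      (FractionalIdeal.mem_coeIdeal_of_mem (P := F) (𝓞 F)⁰ (Ideal.absNorm_mem η.asIdeal))
    rw [map_natCast] at h1
    rwa [Nat.cast_mul, mul_comm]
  have hper := hperiod hM (hl 𝔟⁻¹ m₁ hm₁𝔟)
  have hper' := hperiod hM' (hl I' (q * m₁) hm₁')
  have hfin : ∀ j, (boxReps (arithSet 𝔣 𝔭 𝔟⁻¹ 𝓤) (m₁ * m₂ * m₃ ^ l) (v j)).Finite := fun j =>
    finite_boxReps (fun x hx => hx.2.1) _ _
  have hfin' : ∀ j, (boxReps (arithSet 𝔣 𝔭 I' 𝓤) (q * m₁ * m₂ * m₃ ^ l) (v j)).Finite := fun j =>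
    finite_boxReps (fun x hx => hx.2.1) _ _
  have hmax : η.asIdeal.IsMaximal := η.isMaximal
  have hηfin : Finite (𝓞 F ⧸ η.asIdeal) := Ideal.finiteQuotientOfFreeOfNeBot _ η.ne_bot
  have hcard : Nat.card (𝓞 F ⧸ η.asIdeal) = q := by
    rw [hqdef, Ideal.absNorm_apply, Submodule.cardQuot_apply]
  obtain ⟨V, hV⟩ := exists_smoothed_value (S' := arithSet 𝔣 𝔭 I' 𝓤) (hcard ▸ hq) hdec hpos hM hper
    hfin (redMod η.asIdeal N)
    (fun j i => Ideal.Quotient.mk η.asIdeal ((N * (m₁ * m₂ * m₃ ^ l) : ℕ) * v j i))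
    (fun j i h => by
      rw [Ideal.Quotient.eq_zero_iff_mem] at h
      rcases η.isPrime.mem_or_mem h with h | h
      · refine natCast_notMem_of_not_dvd η hq ?_ h
        rw [hq.dvd_mul]
        rintro (h | h)
        exacts [hqN h, hqM h]
      · exact (hv j).1 i h)
    (fun j x hx n => redMod_shift (exists_eq_natCast_mul h𝔟 hN𝔟 hx.1.2.1) _ _ _)
    (fun z => by
      have hnot : ((m₁ * N : ℕ) : 𝓞 F) ∉ η.asIdeal := by
        refine natCast_notMem_of_not_dvd η hq ?_
        rw [hq.dvd_mul]
        rintro (h | h)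
        exacts [hqm₁ h, hqN h]
      have hle : ∀ z ∈ I', z ∈ 𝔟⁻¹ := by
        intro z hz
        have h1 : I' ≤ 𝔟⁻¹ * 1 := mul_le_mul_right FractionalIdeal.coeIdeal_le_one 𝔟⁻¹
        rw [mul_one] at h1
        exact h1 hz
      constructor
      · rintro ⟨h1, h2, h3⟩
        exact ⟨⟨h1, hle z h2, h3⟩,
          (redMod_eq_zero_iff h𝔟 hN𝔟 hm₁𝔟 hnot (hle z h2)).2 h2⟩
      · rintro ⟨⟨h1, h2, h3⟩, h4⟩
        exact ⟨h1, (redMod_eq_zero_iff h𝔟 hN𝔟 hm₁𝔟 hnot h2).1 h4, h3⟩)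
  rw [hcard] at hV
  rw [hnorm, hι]
  have hc := fun (T : Type _) [Fintype T] [Nonempty T] (e : T → F →+* ℝ) =>
    hasContinuation_of_periodic e hdec hpos hM hper hfin
  have hc' := fun (T : Type _) [Fintype T] [Nonempty T] (e : T → F →+* ℝ) =>
    hasContinuation_of_periodic e hdec hpos hM' hper' hfin'
  refine ⟨⟨hc _ id, hc' _ id, hc PUnit fun _ => ι, hc' PUnit fun _ => ι⟩, ?_⟩
  -- Both smoothed values equal the same V.
  rw [hV _ id (hc' _ id), hV PUnit (fun _ => ι) (hc' PUnit fun _ => ι)]
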